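/- For elements $x,q$ of a field and an integer $k\ge 0$ let $(x;q)_k=\prod_{j=0}^{k-1}(1-xq^j)$, write $(x_1,\dots,x_s;q)_k=(x_1;q)_k\cdots(x_s;q)_k$, let $[s]=(1-q^s)/(1-q)$, and let $\Phi_n(q)$ be the $n$-th cyclotomic polynomial. Let $a$ and $q$ be independent variables. For a polynomial $P\in\mathbb{Q}[a,q]$ and rational functions $A,B\in\mathbb{Q}(a,q)$, the congruence $A\equiv B\pmod P$ means that $A-B=PN/D$ for some $N,D\in\mathbb{Q}[a,q]$ with $D\neq0$ having no common factor with $P$. **Theorem.** Let $d,m,n,r$ be positive integers such that $r\le n$, $n\equiv r\pmod d$, $\gcd(r,d)=1$ and $d\ge m\ge 2$. For $k\ge 0$ put $$\lambda_q(k)=[2dk+r]\,\frac{(q^r;q^d)_k^4\,(aq^r,q^r/a;q^d)_k}{(q^d;q^d)_k^4\,(q^d/a,aq^d;q^d)_k}\,q^{(2d-3r)k}.$$ Then, modulo $\Phi_n(q)^4(1-aq^n)(a-q^n)$, $$\begin{aligned} \sum_{i_1+\cdots+i_m\le n-1}&\lambda_q(i_1)\cdots\lambda_q(i_m)\\ \equiv{}&[n]^m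 q^{mr(r-n)/d}\,\frac{(1-q^n)^2(1+a^2-aq^n)}{(1-a)^2}\,\frac{(q^{2r};q^d)_{(n-r)/d}^m}{(q^d;q^d)_{(n-r)/d}^m} \left\{\sum_{k=0}^{(n-r)/d}\frac{(aq^r,q^r/a,q^r,q^{d-r};q^d)_k}{(q^d;q^d)_k^3\,(q^{2r};q^d)_k}\,q^{dk}\right\}^m\\ &-[n]^m q^{mr(r-n)/d}\,\frac{(2-q^n)(1-aq^n)(a-q^n)}{(1-a)^2}\,\frac{(q^{2r};q^d)_{(n-r)/d}^m}{(q^d;q^d)_{(n-r)/d}^m} \left\{\sum_{k=0}^{(n-r)/d}\frac{(q^r;q^d)_k^3\,(q^{d-r};q^d)_k}{(aq^d,q^d/a,q^d,q^{2r};q^d)_k}\,q^{dk}\right\}^m, \end{aligned}$$ where the sum on the left runs over all nonnegative integers $i_1,\dots,i_m$ with $i_1+\cdots+i_m\le n-1$. -/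

import Mathlib

open Polynomial

/-- The `q`-shifted factorial `(x; q)_n = (1 - x) (1 - x q) ⋯ (1 - x q ^ (n - 1))`. -/
def qPoch {K : Type*} [Field K] (x q : K) (n : ℕ) : K :=
  ∏ j ∈ Finset.range n, (1 - x * q ^ j)

/-- The `q`-integer `[s] = (1 - q ^ s) / (1 - q)`. -/
def qInt {K : Type*} [Field K] (q : K) (s : ℕ) : K :=
  (1 - q ^ s) / (1 - q)

/-- The term
`[2dk+r] (q^r;q^d)_k^4 (a q^r, q^r/a; q^d)_k / ((q^d;q^d)_k^4 (q^d/a, a q^d; q^d)_k) q^((2d-3r)k)`. -/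
def qLambda {K : Type*} [Field K] (d r : ℕ) (a q : K) (k : ℕ) : K :=
  qInt q (2 * d * k + r) *
    ((qPoch (q ^ r) (q ^ d) k ^ 4 * (qPoch (a * q ^ r) (q ^ d) k * qPoch (q ^ r / a) (q ^ d) k)) /
      (qPoch (q ^ d) (q ^ d) k ^ 4 *
        (qPoch (q ^ d / a) (q ^ d) k * qPoch (a * q ^ d) (q ^ d) k))) *
    q ^ ((2 * (d : ℤ) - 3 * (r : ℤ)) * (k : ℤ))

/-- Congruence of elements of a fraction field modulo `P` : the difference `A - B` is a fraction
whose numerator is divisible by `P` and whose denominator has no common factor with `P`. -/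
def FracCongr {R : Type*} [CommRing R] [IsDomain R] (P : R) (A B : FractionRing R) : Prop :=
  ∃ N D : R, D ≠ 0 ∧ IsRelPrime D P ∧
    A - B = algebraMap R (FractionRing R) (P * N) / algebraMap R (FractionRing R) D

/-- The polynomial ring `ℚ[a, q]`, as polynomials in `q` over `ℚ[a]`. -/
abbrev PolyAQ : Type := Polynomial (Polynomial ℚ)

/-- The field `ℚ(a, q)` of rational functions in two independent variables. -/
abbrev RatAQ : Type := FractionRing PolyAQ

/-- The variable `a` of `ℚ[a, q]`. -/
noncomputable def polyA : PolyAQ := C X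

/-- The variable `q` of `ℚ[a, q]`. -/
noncomputable def polyQ : PolyAQ := X

/-- The variable `a` as a rational function. -/
noncomputable def ratA : RatAQ := algebraMap PolyAQ RatAQ polyA

/-- The variable `q` as a rational function. -/
noncomputable def ratQ : RatAQ := algebraMap PolyAQ RatAQ polyQ

/-- The modulus `Φ_n(q)^4 (1 - a q^n) (a - q^n)`. The cyclotomic polynomial over the coefficient
ring `ℚ[a]` is `Φ_n` in the outer variable `q`. -/
noncomputable def modulusAQ (n : ℕ) : PolyAQ :=
  cyclotomic n (Polynomial ℚ) ^ 4 * (1 - polyA * polyQ ^ n) * (polyA - polyQ ^ n)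

/-- The sum of `f i_1 ⋯ f i_m` over all nonnegative integers with `i_1 + ⋯ + i_m ≤ N`. -/
def multiSum {K : Type*} [Field K] (m N : ℕ) (f : ℕ → K) : K :=
  ∑ i ∈ (Fintype.piFinset fun _ : Fin m => Finset.range (N + 1)) with ∑ j, i j ≤ N,
    ∏ j, f (i j)

/-! Put A = q^r, Q = q^d and n = r + dM, so that A Q^M = q^n. Up to the factor 1/(1 - q), the
summand is the case b = 1 of a very-well-poised term `wTerm` with the parameter pairs (aA, A/a) and
(bA, A/b). For b = q^n the series stops at k = M, and Watson's transformation (`watson`, obtained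
from the unit Bailey pair by two Bailey steps) turns it into `prefactor` times a balanced sum
`balSum`; the prefactor carries [n].

Since mM ≤ dM = n - r ≤ n - 1, every tuple with entries at most M is admitted. Hence the multiple
sum is S^m, with S the sum of λ(k) over k ≤ M, plus products containing some λ(k) with M < k < n
(`multiSum_eq_pow_add`).

If a = q^n or a = q^(-n), those products vanish, Watson with a and b exchanged evaluates S, and the
two rational coefficients on the right become 1 and 0. This settles the factors 1 - aq^n and a -
q^n.

Modulo Φ_n^4 those products vanish too, because (q^r;q^d)_k^4 contains (1 - q^n)^4. The parameter b
enters only through y = (1 - b)^2/b, a multiple of Φ_n^2 at b = q^n. Replacing b = q^n by b = 1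
changes the sum to first order by a multiple of y Σ w_k H_k (w_k = `wTerm`, H_k = `logDerivSum`).
Where A Q^M = 1, the reflection k → M - k makes w_k odd and H_k even, so this sum vanishes modulo
Φ_n and the change is O(Φ_n^3). On the balanced side, [n] and y give the same precision. So S ≡ T
mod Φ_n^3, where T is the prefactor times the balanced sum at b = 1. Both are multiples of Φ_n, and
m ≥ 2 yields S^m ≡ T^m mod Φ_n^4. The signed coefficients on the right add up to 1 and the first
contains (1 - q^n)^2, so the right side is also T^m mod Φ_n^4.

Work modulo a prime p takes place in the fraction field of ℚ[a,q]/(p). Denominators are controlled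
by specialising to one complex point of p = 0, and coprime moduli are combined by
`FracCongr.mul_modulus`. -/

set_option linter.unusedSectionVars false

/-! ### Saalschütz summation and the Bailey lemma. -/

section Hypergeometric

variable {K : Type*} [Field K]

@[simp] theorem qPoch_zero (x q : K) : qPoch x q 0 = 1 := by simp [qPoch]

theorem qPoch_succ (x q : K) (n : ℕ) : qPoch x q (n + 1) = qPoch x q n * (1 - x * q ^ n) := by
  simp [qPoch, Finset.prod_range_succ]

theorem qPoch_add (x q : K) (k l : ℕ) :
    qPoch x q (k + l) = qPoch x q k * qPoch (x * q ^ k) q l := by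
  simp only [qPoch, Finset.prod_range_add, pow_add, mul_assoc]

theorem qPoch_ne_zero {x q : K} {n : ℕ} (h : ∀ i < n, x * q ^ i ≠ 1) : qPoch x q n ≠ 0 :=
  Finset.prod_ne_zero_iff.2 fun i hi => sub_ne_zero.2 (h i (Finset.mem_range.1 hi)).symm

theorem qPoch_eq_zero {x q : K} {i n : ℕ} (hi : i < n) (h : x * q ^ i = 1) : qPoch x q n = 0 :=
  Finset.prod_eq_zero (Finset.mem_range.2 hi) (by rw [h, sub_self])

/-- Reversal of the order of the factors of a `q`-shifted factorial. -/
theorem qPoch_mul_qPoch_reverse {x y q : K} (j l : ℕ) (h : x * y * q ^ (j + l) = q) (hq : q ≠ 0) :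
    qPoch x q j * qPoch y q l = (-x) ^ j * q ^ (j.choose 2) * qPoch y q (j + l) := by
  induction j generalizing l with
  | zero => simp
  | succ j ih =>
    have h1 := ih (l + 1) (by linear_combination h)
    have h2 : (j + 1).choose 2 = j + j.choose 2 := by
      simp [Nat.choose_succ_succ']
    have h3 : (1 - x * q ^ j) = -x * q ^ j * (1 - y * q ^ l) := by
      have h4 : q * (x * y * q ^ (j + l)) = q * 1 := by linear_combination h
      have h5 := mul_left_cancel₀ hq h4
      linear_combination -h5
    rw [qPoch_succ] at h1
    rw [qPoch_succ, h3, h2, show j + 1 + l = j + (l + 1) by ring, pow_add, pow_succ]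
    linear_combination (-x * q ^ j) * h1

/-- Summand of the `q`-Pfaff–Saalschütz sum in symmetric form. -/
def saalTerm (d e u q : K) (i t : ℕ) : K :=
  qPoch d q i * qPoch e q i * qPoch u q t * u ^ i /
    (qPoch q q i * qPoch q q t * qPoch (d * e * u) q i)

/-- With p = L + t fixed, this is the telescoped form of a first-order recurrence in p for the full
sums. At t = 0 the right-hand side cancels against the missing term i = p + 1. -/
theorem saalTerm_partial_sum {d e u q : K} (hq : ∀ i, q * q ^ i ≠ 1)
    (hB : ∀ i, d * e * u * q ^ i ≠ 1) (L t : ℕ) :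
    (1 - q * q ^ (L + t)) * (1 - d * e * u * q ^ (L + t)) *
        ∑ i ∈ Finset.range (L + 1), saalTerm d e u q i (L + t + 1 - i) -
      (1 - e * u * q ^ (L + t)) * (1 - d * u * q ^ (L + t)) *
        ∑ i ∈ Finset.range (L + 1), saalTerm d e u q i (L + t - i) =
      -(qPoch d q (L + 1) * qPoch e q (L + 1) * qPoch u q t * u ^ (L + 1) * q ^ t) /
        (qPoch q q L * qPoch q q t * qPoch (d * e * u) q L) := by
  induction L generalizing t with
  | zero =>
    have h1 : qPoch q q t ≠ 0 := qPoch_ne_zero fun i _ => hq i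
    have h2 : 1 - q * q ^ t ≠ 0 := sub_ne_zero.2 (hq t).symm
    simp [saalTerm, qPoch_succ]
    field_simp
    ring
  | succ L ih =>
    have h := ih (t + 1)
    rw [Finset.sum_range_succ, Finset.sum_range_succ _ (L + 1)]
    rw [show L + (t + 1) = L + 1 + t by ring] at h
    rw [mul_add, mul_add, add_sub_add_comm, h,
      show L + 1 + t + 1 - (L + 1) = t + 1 by omega, show L + 1 + t - (L + 1) = t by omega]
    have h1 : qPoch q q t ≠ 0 := qPoch_ne_zero fun i _ => hq i
    have h2 : 1 - q * q ^ t ≠ 0 := sub_ne_zero.2 (hq t).symm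
    have h3 : qPoch q q L ≠ 0 := qPoch_ne_zero fun i _ => hq i
    have h4 : 1 - q * q ^ L ≠ 0 := sub_ne_zero.2 (hq L).symm
    have h5 : qPoch (d * e * u) q L ≠ 0 := qPoch_ne_zero fun i _ => hB i
    have h6 : 1 - d * e * u * q ^ L ≠ 0 := sub_ne_zero.2 (hB L).symm
    simp only [saalTerm, qPoch_succ, pow_add, pow_one]
    generalize qPoch q q t = x1 at *
    generalize qPoch q q L = x2 at *
    generalize qPoch (d * e * u) q L = x3 at *
    generalize q ^ t = x4 at *
    generalize q ^ L = x5 at *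
    generalize hz1 : 1 - q * x4 = z1 at *
    generalize hz2 : 1 - q * x5 = z2 at *
    generalize hz3 : 1 - d * e * u * x5 = z3 at *
    field_simp
    subst hz1 hz2 hz3
    ring

/-- The `q`-Pfaff–Saalschütz summation. -/
theorem sum_saalTerm {d e u q : K} (hq : ∀ i, q * q ^ i ≠ 1)
    (hB : ∀ i, d * e * u * q ^ i ≠ 1) (p : ℕ) :
    ∑ i ∈ Finset.range (p + 1), saalTerm d e u q i (p - i) =
      qPoch (e * u) q p * qPoch (d * u) q p / (qPoch q q p * qPoch (d * e * u) q p) := by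
  induction p with
  | zero => simp [saalTerm]
  | succ p ih =>
    have h := saalTerm_partial_sum hq hB p 0
    simp only [add_zero, ih] at h
    rw [Finset.sum_range_succ]
    have h3 : qPoch q q p ≠ 0 := qPoch_ne_zero fun i _ => hq i
    have h4 : 1 - q * q ^ p ≠ 0 := sub_ne_zero.2 (hq p).symm
    have h5 : qPoch (d * e * u) q p ≠ 0 := qPoch_ne_zero fun i _ => hB i
    have h6 : 1 - d * e * u * q ^ p ≠ 0 := sub_ne_zero.2 (hB p).symm
    generalize ∑ i ∈ Finset.range (p + 1), saalTerm d e u q i (p + 1 - i) = X at h ⊢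
    have h7 := sub_eq_iff_eq_add.1 h
    have h8 : X = ((1 - q * q ^ p) * (1 - d * e * u * q ^ p) * X) /
      ((1 - q * q ^ p) * (1 - d * e * u * q ^ p)) :=
      (mul_div_cancel_left₀ X (mul_ne_zero h4 h6)).symm
    rw [h8, h7]
    simp only [saalTerm, qPoch_succ, Nat.sub_self, qPoch_zero, pow_zero]
    generalize qPoch q q p = x1 at *
    generalize qPoch (d * e * u) q p = x3 at *
    generalize q ^ p = x4 at *
    generalize hz2 : 1 - q * x4 = z2 at *
    generalize hz3 : 1 - d * e * u * x4 = z3 at *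
    field_simp
    subst hz2 hz3
    ring

/-- One step of the Bailey chain: the sequences `α`, `β` form a Bailey pair relative to `B / q`
with `B = d e u`. -/
theorem bailey_lemma {d e u q : K} (hq : ∀ i, q * q ^ i ≠ 1)
    (hB : ∀ i, d * e * u * q ^ i ≠ 1) {N : ℕ} (hdu : ∀ i < N, d * u * q ^ i ≠ 1)
    (heu : ∀ i < N, e * u * q ^ i ≠ 1) {α β : ℕ → K}
    (hαβ : ∀ j ≤ N, β j = ∑ l ∈ Finset.range (j + 1),
      α l / (qPoch q q (j - l) * qPoch (d * e * u) q (j + l))) :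
    ∑ l ∈ Finset.range (N + 1),
        qPoch d q l * qPoch e q l / (qPoch (e * u) q l * qPoch (d * u) q l) * u ^ l * α l /
          (qPoch q q (N - l) * qPoch (d * e * u) q (N + l)) =
      ∑ j ∈ Finset.range (N + 1),
        qPoch d q j * qPoch e q j * qPoch u q (N - j) * u ^ j /
          (qPoch q q (N - j) * (qPoch (e * u) q N * qPoch (d * u) q N)) * β j := by
  have hqn : ∀ k, qPoch q q k ≠ 0 := fun k => qPoch_ne_zero fun i _ => hq i
  -- After the interchange of summations, the inner sum over j = l + i is Saalschütz's sum for d q^l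
  -- and e q^l.
  have key : ∀ l p, l + p = N → ∑ i ∈ Finset.range (p + 1),
      qPoch d q (l + i) * qPoch e q (l + i) * qPoch u q (p - i) * u ^ (l + i) /
        (qPoch q q (p - i) * (qPoch (e * u) q N * qPoch (d * u) q N)) *
        (1 / (qPoch q q i * qPoch (d * e * u) q (l + i + l))) =
      qPoch d q l * qPoch e q l / (qPoch (e * u) q l * qPoch (d * u) q l) * u ^ l /
          (qPoch q q p * qPoch (d * e * u) q (N + l)) := by
    intro l p hlp
    have hB' : ∀ i, (d * q ^ l) * (e * q ^ l) * u * q ^ i ≠ 1 := by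
      intro i
      have := hB (l + l + i)
      intro h
      apply this
      rw [← h]; ring
    have hs := sum_saalTerm hq hB' p
    have e1 : ∀ k, qPoch (d * e * u) q (l + k + l) = qPoch (d * e * u) q (l + l) *
        qPoch ((d * q ^ l) * (e * q ^ l) * u) q k := by
      intro k
      rw [show l + k + l = l + l + k by ring, qPoch_add _ _ (l + l)]
      congr 2
      ring
    have hne : ∀ k, qPoch ((d * q ^ l) * (e * q ^ l) * u) q k ≠ 0 :=
      fun k => qPoch_ne_zero fun i _ => hB' i
    have hne2 : qPoch (d * e * u) q (l + l) ≠ 0 := qPoch_ne_zero fun i _ => hB i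
    have f1 : qPoch (e * u) q l ≠ 0 := qPoch_ne_zero fun i hi => heu i (by omega)
    have f2 : qPoch (d * u) q l ≠ 0 := qPoch_ne_zero fun i hi => hdu i (by omega)
    have g1 : qPoch (e * u) q N = qPoch (e * u) q l * qPoch (e * q ^ l * u) q p := by
      rw [← hlp, qPoch_add]; congr 2; ring
    have g2 : qPoch (d * u) q N = qPoch (d * u) q l * qPoch (d * q ^ l * u) q p := by
      rw [← hlp, qPoch_add]; congr 2; ring
    have k1 : qPoch (e * u) q N ≠ 0 := qPoch_ne_zero heu
    have k2 : qPoch (d * u) q N ≠ 0 := qPoch_ne_zero hdu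
    have l1 : qPoch (e * q ^ l * u) q p ≠ 0 := right_ne_zero_of_mul (g1 ▸ k1)
    have l2 : qPoch (d * q ^ l * u) q p ≠ 0 := right_ne_zero_of_mul (g2 ▸ k2)
    calc _ = ∑ i ∈ Finset.range (p + 1), (qPoch d q l * qPoch e q l * u ^ l /
          (qPoch (e * u) q N * qPoch (d * u) q N * qPoch (d * e * u) q (l + l))) *
          saalTerm (d * q ^ l) (e * q ^ l) u q i (p - i) := by
          refine Finset.sum_congr rfl fun i _ => ?_
          have := hqn (p - i)
          have := hqn i
          have := hne i
          rw [e1, qPoch_add d, qPoch_add e, saalTerm, pow_add]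
          field_simp
      _ = _ := by
          have := hqn p
          have := hne p
          rw [← Finset.mul_sum, hs, g1, g2, show N + l = l + p + l by omega, e1]
          generalize qPoch (e * q ^ l * u) q p = x1 at *
          generalize qPoch (d * q ^ l * u) q p = x2 at *
          generalize qPoch (d * q ^ l * (e * q ^ l) * u) q p = x3 at *
          field_simp
  symm
  calc _ = ∑ j ∈ Finset.range (N + 1), ∑ l ∈ Finset.range (j + 1),
        qPoch d q j * qPoch e q j * qPoch u q (N - j) * u ^ j /
          (qPoch q q (N - j) * (qPoch (e * u) q N * qPoch (d * u) q N)) *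
          (1 / (qPoch q q (j - l) * qPoch (d * e * u) q (j + l))) * α l := by
        refine Finset.sum_congr rfl fun j hj => ?_
        rw [hαβ j (by simpa [Nat.lt_succ_iff] using hj), Finset.mul_sum]
        refine Finset.sum_congr rfl fun l _ => ?_
        ring
    _ = ∑ l ∈ Finset.range (N + 1), ∑ j ∈ Finset.Ico l (N + 1),
        qPoch d q j * qPoch e q j * qPoch u q (N - j) * u ^ j /
          (qPoch q q (N - j) * (qPoch (e * u) q N * qPoch (d * u) q N)) *
          (1 / (qPoch q q (j - l) * qPoch (d * e * u) q (j + l))) * α l := by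
        refine Finset.sum_comm' fun j l => ?_
        simp only [Finset.mem_range, Finset.mem_Ico]
        omega
    _ = _ := by
        refine Finset.sum_congr rfl fun l hl => ?_
        have hl' : l ≤ N := by simpa [Nat.lt_succ_iff] using hl
        have hk := key l (N - l) (by omega)
        rw [Finset.sum_Ico_eq_sum_range, ← Finset.sum_mul, show N + 1 - l = N - l + 1 by omega,
          mul_div_right_comm, ← hk]
        congr 1
        refine Finset.sum_congr rfl fun i hi => ?_
        rw [show N - l - i = N - (l + i) by omega, show l + i - l = i by omega]

/-- The unit Bailey pair. -/
theorem unit_bailey_pair {A q : K} (hq : ∀ i, q * q ^ i ≠ 1) (hA : ∀ i, A * q * q ^ i ≠ 1)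
    (N : ℕ) :
    ∑ l ∈ Finset.range (N + 1), (1 - A * q ^ (2 * l)) * qPoch A q l * (-1) ^ l *
        q ^ (l.choose 2) / qPoch q q l / (qPoch q q (N - l) * qPoch (A * q) q (N + l)) =
      if N = 0 then 1 - A else 0 := by
  have hqn : ∀ k, qPoch q q k ≠ 0 := fun k => qPoch_ne_zero fun i _ => hq i
  have hAn : ∀ k, qPoch (A * q) q k ≠ 0 := fun k => qPoch_ne_zero fun i _ => hA i
  have hch : ∀ k : ℕ, (k + 1).choose 2 = k + k.choose 2 := fun k => by
    simp [Nat.choose_succ_succ']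
  -- The partial sums l ≤ L with N = L + t + 1 have a closed form. For t = 0 only the term l = N
  -- remains, and it cancels this closed form.
  have key : ∀ L t, ∑ l ∈ Finset.range (L + 1), (1 - A * q ^ (2 * l)) * qPoch A q l * (-1) ^ l *
        q ^ (l.choose 2) / qPoch q q l /
          (qPoch q q (L + t + 1 - l) * qPoch (A * q) q (L + t + 1 + l)) =
      qPoch A q (L + 1) * (-1) ^ L * q ^ ((L + 1).choose 2) /
        (qPoch q q L * qPoch q q t * qPoch (A * q) q (L + t + 1 + L) * (1 - q * q ^ (L + t))) := by
    intro L
    induction L with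
    | zero =>
      intro t
      have := hqn t
      have := hAn (t + 1)
      have h2 : 1 - q * q ^ t ≠ 0 := sub_ne_zero.2 (hq t).symm
      simp [qPoch_succ]
      field_simp
    | succ L ih =>
      intro t
      have h := ih (t + 1)
      rw [Finset.sum_range_succ, show L + 1 + t = L + (t + 1) by ring, h,
        show L + (t + 1) + 1 - (L + 1) = t + 1 by omega,
        show L + (t + 1) + 1 + (L + 1) = L + (t + 1) + 1 + L + 1 by ring]
      have := hqn t
      have := hqn L
      have := hAn (L + (t + 1) + 1 + L)
      have h2 : 1 - q * q ^ t ≠ 0 := sub_ne_zero.2 (hq t).symm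
      have h3 : 1 - q * q ^ L ≠ 0 := sub_ne_zero.2 (hq L).symm
      have h4 : 1 - q * q ^ (L + (t + 1)) ≠ 0 := sub_ne_zero.2 (hq _).symm
      have h5 : 1 - A * q * q ^ (L + (t + 1) + 1 + L) ≠ 0 := sub_ne_zero.2 (hA _).symm
      rw [hch (L + 1), show 2 * (L + 1) = L + L + 1 + 1 by ring]
      simp only [qPoch_succ, pow_add, pow_one] at h4 h5 ⊢
      generalize qPoch (A * q) q (L + (t + 1) + 1 + L) = x1 at *
      generalize q ^ (L + 1).choose 2 = x2 at *
      generalize q ^ t = x4 at *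
      generalize q ^ L = x5 at *
      generalize (-1 : K) ^ L = x6 at *
      generalize hz1 : 1 - q * x4 = z1 at *
      generalize hz2 : 1 - q * x5 = z2 at *
      generalize hz3 : 1 - q * (x5 * (x4 * q)) = z3 at *
      generalize hz4 : 1 - A * q * (x5 * (x4 * q) * q * x5) = z4 at *
      field_simp
      subst hz1 hz2 hz3 hz4
      ring
  cases N with
  | zero => simp
  | succ N =>
    have h := key N 0
    simp only [add_zero] at h
    rw [Finset.sum_range_succ, h]
    have := hqn N
    have := hAn (N + 1 + N)
    have h3 : 1 - q * q ^ N ≠ 0 := sub_ne_zero.2 (hq N).symm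
    have h5 : 1 - A * q * q ^ (N + 1 + N) ≠ 0 := sub_ne_zero.2 (hA _).symm
    rw [show N + 1 + (N + 1) = N + 1 + N + 1 by ring]
    simp [qPoch_succ]
    field_simp
    ring

end Hypergeometric

/-! ### Watson's transformation and the reflection of the well-poised terms. -/

section Watson

variable {K : Type*} [Field K]

/-- Summand of the very-well-poised series with parameters `A; A, a A, A / a, b A, A / b` in
base `q`. -/
def wTerm (A q a b : K) (k : ℕ) : K :=
  (1 - A * q ^ (2 * k)) *
    ((qPoch A q k ^ 2 * (qPoch (a * A) q k * qPoch (A / a) q k) *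
        (qPoch (b * A) q k * qPoch (A / b) q k)) /
      (qPoch q q k ^ 2 * (qPoch (q / a) q k * qPoch (a * q) q k) *
        (qPoch (q / b) q k * qPoch (b * q) q k))) *
    (q ^ 2 / A ^ 3) ^ k

theorem wTerm_swap (A q a b : K) (k : ℕ) : wTerm A q a b k = wTerm A q b a k := by
  simp only [wTerm]
  congr 2
  ring

theorem wTerm_inv (A q a b : K) (k : ℕ) : wTerm A q a⁻¹ b k = wTerm A q a b k := by
  simp only [wTerm, div_inv_eq_mul, inv_mul_eq_div, mul_comm A a, mul_comm q a]
  congr 2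
  ring

/-- The balanced series on the right-hand side of Watson's transformation. -/
def balTerm (A q a b : K) (k : ℕ) : K :=
  (qPoch A q k * (qPoch (b * A) q k * qPoch (A / b) q k) * qPoch (q / A) q k) /
    (qPoch (a * q) q k * qPoch (q / a) q k * qPoch q q k * qPoch (A ^ 2) q k) * q ^ k

theorem balTerm_inv_right (A q a b : K) (k : ℕ) : balTerm A q a b⁻¹ k = balTerm A q a b k := by
  simp only [balTerm, div_inv_eq_mul, inv_mul_eq_div, mul_comm A b]
  congr 2
  ring

/-- Watson's transformation of a terminating very-well-poised series, for `b = A q ^ N`. -/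
theorem watson {A q a : K} {N : ℕ} (hA0 : A ≠ 0) (hq0 : q ≠ 0) (ha0 : a ≠ 0)
    (hq : ∀ i, q * q ^ i ≠ 1) (hA : ∀ i, A * q ^ i ≠ 1) (hA2 : ∀ i < N, A ^ 2 * q ^ i ≠ 1)
    (ha : ∀ i < N, a * q * q ^ i ≠ 1) (ha' : ∀ i < N, q / a * q ^ i ≠ 1)
    (hb' : ∀ i < N, q / (A * q ^ N) * q ^ i ≠ 1) :
    ∑ k ∈ Finset.range (N + 1), wTerm A q a (A * q ^ N) k =
      (1 - A * q ^ N) * (A⁻¹ ^ N * (qPoch (A ^ 2) q N / qPoch q q N)) *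
        ∑ k ∈ Finset.range (N + 1), balTerm A q a (A * q ^ N) k := by
  obtain ⟨b, hb⟩ : ∃ b, b = A * q ^ N := ⟨_, rfl⟩
  rw [← hb] at hb' ⊢
  have hb0 : b ≠ 0 := by rw [hb]; positivity
  have hAq : ∀ i, A * q * q ^ i ≠ 1 := fun i h => hA (i + 1) (by rw [← h]; ring)
  have hqn : ∀ k, qPoch q q k ≠ 0 := fun k => qPoch_ne_zero fun i _ => hq i
  have hAqn : ∀ k, qPoch (A * q) q k ≠ 0 := fun k => qPoch_ne_zero fun i _ => hAq i
  have hAn : ∀ k, qPoch A q k ≠ 0 := fun k => qPoch_ne_zero fun i _ => hA i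
  have hA2n : ∀ k ≤ N, qPoch (A ^ 2) q k ≠ 0 :=
    fun k hk => qPoch_ne_zero fun i hi => hA2 i (by omega)
  have hun : qPoch (q / b) q N ≠ 0 := qPoch_ne_zero hb'
  have E1 : a * A * (A / a) * (q / A) = A * q := by field_simp
  have E2 : A / a * (q / A) = q / a := by field_simp
  have E3 : a * A * (q / A) = a * q := by field_simp
  have E4 : A * (b * A) * (q / (A * b)) = A * q := by field_simp
  have E5 : b * A * (q / (A * b)) = q := by field_simp
  have E6 : A * (q / (A * b)) = q / b := by field_simp
  -- First Bailey step, from the unit pair. Here d e u = A q, and again in the second step, so the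
  -- two can be chained.
  have step1 : ∀ j ≤ N, qPoch (q / A) q j /
        (qPoch q q j * (qPoch (q / a) q j * qPoch (a * q) q j)) * (1 - A) =
      ∑ l ∈ Finset.range (j + 1), (qPoch (a * A) q l * qPoch (A / a) q l /
        (qPoch (q / a) q l * qPoch (a * q) q l) * (q / A) ^ l *
        ((1 - A * q ^ (2 * l)) * qPoch A q l * (-1) ^ l * q ^ (l.choose 2) / qPoch q q l)) /
          (qPoch q q (j - l) * qPoch (A * q) q (j + l)) := by
    intro j hj
    have h := bailey_lemma (d := a * A) (e := A / a) (u := q / A) (N := j)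
      (α := fun l => (1 - A * q ^ (2 * l)) * qPoch A q l * (-1) ^ l * q ^ (l.choose 2) /
        qPoch q q l) (β := fun j => if j = 0 then 1 - A else 0) hq
      (by rw [E1]; exact hAq) (by rw [E3]; exact fun i hi => ha i (by omega))
      (by rw [E2]; exact fun i hi => ha' i (by omega))
      (fun j _ => by rw [E1]; exact (unit_bailey_pair hq hAq j).symm)
    rw [E1, E2, E3] at h
    rw [h, Finset.sum_eq_single 0 (fun i _ hi => by simp [hi]) (fun h => by simp at h)]
    simp
  -- Second Bailey step, which brings in b.
  have h := bailey_lemma (d := A) (e := b * A) (u := q / (A * b)) (N := N) hq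
      (by rw [E4]; exact hAq) (by rw [E6]; exact hb')
      (by rw [E5]; exact fun i _ => hq i)
      (by rw [E4]; exact step1)
  rw [E4, E5, E6] at h
  -- Since A/b = q^(-N), reversal trades the factorials of length N - l for factorials of length l.
  have c1 : ∀ l t, l + t = N → qPoch (A / b) q l * qPoch q q t =
      (-(A / b)) ^ l * q ^ (l.choose 2) * qPoch q q N := by
    intro l t hlt
    rw [← hlt]
    refine qPoch_mul_qPoch_reverse l t ?_ hq0
    rw [hlt, hb]; field_simp
  have c3 : ∀ l t, l + t = N → qPoch (A ^ 2) q l * qPoch (q / (A * b)) q t =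
      (-(A ^ 2)) ^ l * q ^ (l.choose 2) * qPoch (q / (A * b)) q N := by
    intro l t hlt
    rw [← hlt]
    refine qPoch_mul_qPoch_reverse l t ?_ hq0
    rw [hlt, hb]; field_simp
  have c5 : qPoch A q N = (-A) ^ N * q ^ (N.choose 2) * qPoch (q / b) q N := by
    have := qPoch_mul_qPoch_reverse (x := A) (y := q / b) (q := q) N 0
      (by rw [add_zero, hb]; field_simp) hq0
    simpa using this
  have c4 := c3 N 0 (add_zero N)
  rw [qPoch_zero, mul_one] at c4
  have c6 : (1 - A) * qPoch (A * q) q N = qPoch A q N * (1 - A * q ^ N) := by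
    rw [← qPoch_succ, add_comm N 1, qPoch_add]; simp [qPoch_succ]
  have L : ∀ l ∈ Finset.range (N + 1), wTerm A q a b l = qPoch q q N * qPoch (A * q) q N *
      (qPoch A q l * qPoch (b * A) q l / (qPoch q q l * qPoch (q / b) q l) * (q / (A * b)) ^ l *
        (qPoch (a * A) q l * qPoch (A / a) q l /
        (qPoch (q / a) q l * qPoch (a * q) q l) * (q / A) ^ l *
        ((1 - A * q ^ (2 * l)) * qPoch A q l * (-1) ^ l * q ^ (l.choose 2) / qPoch q q l)) /
          (qPoch q q (N - l) * qPoch (A * q) q (N + l))) := by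
    intro l hl
    have hl' : l ≤ N := by simpa [Nat.lt_succ_iff] using hl
    have c := c1 l (N - l) (by omega)
    have c2 : qPoch (A * q) q (N + l) = qPoch (A * q) q N * qPoch (b * q) q l := by
      rw [qPoch_add, hb]; congr 2; ring
    have n1 := hAqn (N + l)
    rw [c2] at n1 ⊢
    have n2 := right_ne_zero_of_mul n1
    have n3 := hqn l
    have n4 := hqn (N - l)
    have n5 := hqn N
    have n6 := hAqn N
    have c' : qPoch (A / b) q l =
        (-(A / b)) ^ l * q ^ (l.choose 2) * qPoch q q N / qPoch q q (N - l) := by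
      rw [eq_div_iff n4, c]
    have pw : (-(A / b)) ^ l * (q ^ 2 / A ^ 3) ^ l =
        (q / (A * b)) ^ l * (q / A) ^ l * (-1) ^ l := by
      rw [← mul_pow, ← mul_pow, ← mul_pow]; congr 1; field_simp
    rw [wTerm, c']
    calc _ = (1 - A * q ^ (2 * l)) *
    ((qPoch A q l ^ 2 * (qPoch (a * A) q l * qPoch (A / a) q l) *
        (qPoch (b * A) q l * (q ^ (l.choose 2) * qPoch q q N / qPoch q q (N - l)))) /
      (qPoch q q l ^ 2 * (qPoch (q / a) q l * qPoch (a * q) q l) *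
        (qPoch (q / b) q l * qPoch (b * q) q l))) *
        ((-(A / b)) ^ l * (q ^ 2 / A ^ 3) ^ l) := by ring
      _ = _ := by
        rw [pw]
        field_simp
  rw [Finset.sum_congr rfl L, ← Finset.mul_sum, h, Finset.mul_sum, Finset.mul_sum]
  refine Finset.sum_congr rfl fun j hj => ?_
  have hj' : j ≤ N := by simpa [Nat.lt_succ_iff] using hj
  have d1 := c1 j (N - j) (by omega)
  have d3 := c3 j (N - j) (by omega)
  have n1 := hqn (N - j)
  have n2 := hqn N
  have n3 := hA2n j hj'
  have d3' : qPoch (q / (A * b)) q (N - j) =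
      (-(A ^ 2)) ^ j * q ^ (j.choose 2) * qPoch (q / (A * b)) q N / qPoch (A ^ 2) q j := by
    rw [eq_div_iff n3, ← d3]; ring
  have n6 : (-(A / b)) ^ j * q ^ (j.choose 2) * qPoch q q N ≠ 0 := by
    have : -(A / b) ≠ 0 := neg_ne_zero.2 (div_ne_zero hA0 hb0)
    positivity
  have n7 : qPoch (A / b) q j ≠ 0 := left_ne_zero_of_mul (d1 ▸ n6)
  have d1' : (qPoch q q (N - j))⁻¹ =
      qPoch (A / b) q j / ((-(A / b)) ^ j * q ^ (j.choose 2) * qPoch q q N) := by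
    rw [← d1]; field_simp
  have pw : (-(A ^ 2)) ^ j * (q / (A * b)) ^ j = (-(A / b)) ^ j * q ^ j := by
    rw [← mul_pow, ← mul_pow]; congr 1; field_simp
  have pw2 : A⁻¹ ^ N * (-(A ^ 2)) ^ N = (-A) ^ N := by
    rw [← mul_pow]; congr 1; field_simp
  rw [balTerm, c4]
  have R : qPoch A q N / qPoch (q / b) q N = (-A) ^ N * q ^ (N.choose 2) := by
    rw [c5]; field_simp
  have n8 : (-(A / b)) ^ j ≠ 0 := pow_ne_zero _ (neg_ne_zero.2 (div_ne_zero hA0 hb0))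
  calc _ = ((1 - A) * qPoch (A * q) q N) / qPoch (q / b) q N * (qPoch q q N / qPoch q q N) *
        (qPoch A q j * qPoch (b * A) q j * qPoch (q / A) q j /
          (qPoch q q j * (qPoch (q / a) q j * qPoch (a * q) q j))) *
        (qPoch (q / (A * b)) q (N - j) * (q / (A * b)) ^ j * (qPoch q q (N - j))⁻¹) := by
        ring
    _ = (1 - A * q ^ N) * (qPoch A q N / qPoch (q / b) q N) * (qPoch q q N / qPoch q q N) *
        (qPoch A q j * qPoch (b * A) q j * qPoch (q / A) q j /
          (qPoch q q j * (qPoch (q / a) q j * qPoch (a * q) q j))) *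
        (q ^ (j.choose 2) * qPoch (q / (A * b)) q N / qPoch (A ^ 2) q j *
          ((-(A ^ 2)) ^ j * (q / (A * b)) ^ j) * (qPoch q q (N - j))⁻¹) := by
        rw [c6, d3']; ring
    _ = _ := by
        have n9 : q ^ j.choose 2 ≠ 0 := pow_ne_zero _ hq0
        rw [R, pw, d1', ← pw2, div_self n2, ← hb]
        generalize (-(A / b)) ^ j = s1 at *
        generalize q ^ j.choose 2 = s2 at *
        generalize qPoch q q N = s3 at *
        rw [show ∀ x y z w : K, s2 * x / y * (s1 * z) * (w / (s1 * s2 * s3)) =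
          x / y * z * w / s3 by intros; field_simp]
        ring

/-- Antisymmetry of the very-well-poised terms when `A = q ^ (-M)`. -/
theorem wTerm_reflect {A q a : K} {k l : ℕ} (h : A * q ^ (k + l) = 1) (hq0 : q ≠ 0)
    (ha0 : a ≠ 0) (hq : ∀ i < k + l, q * q ^ i ≠ 1)
    (ha : ∀ i < k + l, a * q * q ^ i ≠ 1) (ha' : ∀ i < k + l, q / a * q ^ i ≠ 1) :
    wTerm A q a 1 l = -wTerm A q a 1 k := by
  have hA0 : A ≠ 0 := left_ne_zero_of_mul (h ▸ one_ne_zero)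
  have key : ∀ x : K, x ≠ 0 → ∀ i j, i + j = k + l → qPoch (x * A) q i * qPoch (q / x) q j =
      (-(x * A)) ^ i * q ^ (i.choose 2) * qPoch (q / x) q (k + l) := by
    intro x hx i j hij
    rw [← hij]
    refine qPoch_mul_qPoch_reverse i j ?_ hq0
    rw [hij]
    field_simp
    linear_combination h
  have hch : ∀ i : ℕ, 2 * i.choose 2 + i = i * i := by
    intro i
    induction i with
    | zero => simp
    | succ i ih => simp only [Nat.choose_succ_succ', Nat.choose_one_right]; simp; nlinarith
  have g : ∀ i j, i + j = k + l → (1 - A * q ^ (2 * i)) * (A ^ i * q ^ (i.choose 2)) ^ 6 *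
      (q ^ 2 / A ^ 3) ^ i * q ^ (3 * i * j) = A * (q ^ j - q ^ i) := by
    intro i j hij
    have hA1 : A * q ^ i * q ^ j = 1 := by rw [← h, ← hij]; ring
    have e1 : 1 - A * q ^ (2 * i) = A * q ^ i * (q ^ j - q ^ i) := by
      rw [← hA1]; ring
    have e2 : (A ^ i * q ^ (i.choose 2)) ^ 6 * (q ^ 2 / A ^ 3) ^ i * q ^ i =
        (A ^ i) ^ 3 * (q ^ (3 * (i * i))) := by
      rw [div_pow, ← hch]
      field_simp
      ring
    rw [e1]
    calc _ = A * (q ^ j - q ^ i) * ((A ^ i * q ^ (i.choose 2)) ^ 6 * (q ^ 2 / A ^ 3) ^ i * q ^ i) *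
          q ^ (3 * i * j) := by ring
      _ = A * (q ^ j - q ^ i) * (A * q ^ i * q ^ j) ^ (3 * i) := by
          rw [e2]; ring
      _ = _ := by rw [hA1]; simp
  have n1 : ∀ i ≤ k + l, qPoch q q i ≠ 0 :=
    fun i hi => qPoch_ne_zero fun j hj => hq j (by omega)
  have n2 : ∀ i ≤ k + l, qPoch (a * q) q i ≠ 0 :=
    fun i hi => qPoch_ne_zero fun j hj => ha j (by omega)
  have n3 : ∀ i ≤ k + l, qPoch (q / a) q i ≠ 0 :=
    fun i hi => qPoch_ne_zero fun j hj => ha' j (by omega)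
  -- The term is an expression symmetric in i and j times q^j - q^i, which gives the sign.
  have form : ∀ i j, i + j = k + l → wTerm A q a 1 i =
      (qPoch q q (k + l) ^ 4 * (qPoch (a * q) q (k + l) * qPoch (q / a) q (k + l)) /
        ((qPoch q q i * qPoch q q j) ^ 4 * (qPoch (a * q) q i * qPoch (a * q) q j) *
          (qPoch (q / a) q i * qPoch (q / a) q j)) / q ^ (3 * i * j)) * (A * (q ^ j - q ^ i)) := by
    intro i j hij
    have k1 := key 1 one_ne_zero i j hij
    have k2 := key a ha0 i j hij
    have k3 := key a⁻¹ (inv_ne_zero ha0) i j hij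
    simp only [one_mul, div_one, div_inv_eq_mul, inv_mul_eq_div] at k1 k2 k3
    rw [mul_comm q a] at k3
    have m1 := n1 i (by omega)
    have m2 := n2 i (by omega)
    have m3 := n3 i (by omega)
    have m4 := n1 j (by omega)
    have m5 := n2 j (by omega)
    have m6 := n3 j (by omega)
    rw [← eq_div_iff m4] at k1
    rw [← eq_div_iff m6] at k2
    rw [← eq_div_iff m5] at k3
    have s : (-A) ^ i * (-A) ^ i * (-A) ^ i * (-A) ^ i * (-(a * A)) ^ i * (-(A / a)) ^ i =
        (A ^ i) ^ 6 := by
      rw [← mul_pow, ← mul_pow, ← mul_pow, ← mul_pow, ← mul_pow, ← pow_mul, mul_comm i 6, pow_mul]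
      congr 1; field_simp
    rw [← g i j hij, wTerm]
    simp only [one_mul, div_one]
    rw [k1, k2, k3, mul_pow (A ^ i), ← s]
    generalize (-A) ^ i = s1
    generalize (-(a * A)) ^ i = s2
    generalize (-(A / a)) ^ i = s3
    generalize (q ^ 2 / A ^ 3) ^ i = s4
    have m7 : q ^ (3 * i * j) ≠ 0 := pow_ne_zero _ hq0
    generalize q ^ (3 * i * j) = s5 at *
    rw [div_mul_eq_mul_div _ s5, eq_div_iff m7]
    ring
  rw [form k l rfl, form l k (add_comm l k), show 3 * l * k = 3 * k * l by ring]
  ring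

end Watson

/-! ### Localisation at the kernel of a ring map, and congruences of fractions. -/

section Evaluation

variable {R L : Type*} [CommRing R] [IsDomain R] [Field L]

/-- The fraction `x` can be written with a denominator that `φ` does not kill, and the extension of
`φ` takes it to `v`. -/
def EvalsTo (φ : R →+* L) (x : FractionRing R) (v : L) : Prop :=
  ∃ N D : R, φ D ≠ 0 ∧ x * algebraMap R (FractionRing R) D = algebraMap R (FractionRing R) N ∧
    v * φ D = φ N

namespace EvalsTo

variable {φ : R →+* L} {x y : FractionRing R} {v w : L}

theorem of_algebraMap (φ : R →+* L) (a : R) :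
    EvalsTo φ (algebraMap R (FractionRing R) a) (φ a) :=
  ⟨a, 1, by simp, by simp, by simp⟩

theorem zero (φ : R →+* L) : EvalsTo φ 0 0 := by simpa using of_algebraMap φ 0

theorem one (φ : R →+* L) : EvalsTo φ 1 1 := by simpa using of_algebraMap φ 1

theorem natCast (φ : R →+* L) (n : ℕ) : EvalsTo φ n n := by simpa using of_algebraMap φ (n : R)

theorem add (hx : EvalsTo φ x v) (hy : EvalsTo φ y w) : EvalsTo φ (x + y) (v + w) := by
  obtain ⟨N, D, hD, h1, h2⟩ := hx
  obtain ⟨N', D', hD', h1', h2'⟩ := hy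
  refine ⟨N * D' + N' * D, D * D', by simp [hD, hD'], ?_, ?_⟩
  · simp only [map_add, map_mul, ← h1, ← h1']; ring
  · simp only [map_add, map_mul, ← h2, ← h2']; ring

theorem mul (hx : EvalsTo φ x v) (hy : EvalsTo φ y w) : EvalsTo φ (x * y) (v * w) := by
  obtain ⟨N, D, hD, h1, h2⟩ := hx
  obtain ⟨N', D', hD', h1', h2'⟩ := hy
  refine ⟨N * N', D * D', by simp [hD, hD'], ?_, ?_⟩
  · simp only [map_mul, ← h1, ← h1']; ring
  · simp only [map_mul, ← h2, ← h2']; ring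

theorem neg (hx : EvalsTo φ x v) : EvalsTo φ (-x) (-v) := by
  obtain ⟨N, D, hD, h1, h2⟩ := hx
  exact ⟨-N, D, hD, by rw [map_neg, ← h1]; ring, by rw [map_neg, ← h2]; ring⟩

theorem sub (hx : EvalsTo φ x v) (hy : EvalsTo φ y w) : EvalsTo φ (x - y) (v - w) := by
  simpa [sub_eq_add_neg] using hx.add hy.neg

theorem inv (hx : EvalsTo φ x v) (hv : v ≠ 0) : EvalsTo φ x⁻¹ v⁻¹ := by
  obtain ⟨N, D, hD, h1, h2⟩ := hx
  have hN : φ N ≠ 0 := by rw [← h2]; exact mul_ne_zero hv hD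
  have hN' : algebraMap R (FractionRing R) N ≠ 0 := by
    rw [Ne, IsFractionRing.to_map_eq_zero_iff]
    rintro rfl
    simp at hN
  have hx0 : x ≠ 0 := left_ne_zero_of_mul (h1 ▸ hN')
  refine ⟨D, N, hN, ?_, ?_⟩
  · rw [← h1]; field_simp
  · rw [← h2]; field_simp

theorem div (hx : EvalsTo φ x v) (hy : EvalsTo φ y w) (hw : w ≠ 0) :
    EvalsTo φ (x / y) (v / w) := by
  simpa [div_eq_mul_inv] using hx.mul (hy.inv hw)

theorem pow (hx : EvalsTo φ x v) (n : ℕ) : EvalsTo φ (x ^ n) (v ^ n) := by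
  induction n with
  | zero => simpa using one φ
  | succ n ih => simpa [pow_succ] using ih.mul hx

theorem sum {ι : Type*} {s : Finset ι} {f : ι → FractionRing R} {g : ι → L}
    (h : ∀ i ∈ s, EvalsTo φ (f i) (g i)) : EvalsTo φ (∑ i ∈ s, f i) (∑ i ∈ s, g i) := by
  classical
  induction s using Finset.induction_on with
  | empty => simpa using zero φ
  | insert a s ha ih =>
    rw [Finset.sum_insert ha, Finset.sum_insert ha]
    exact (h a (by simp)).add (ih fun i hi => h i (by simp [hi]))

theorem prod {ι : Type*} {s : Finset ι} {f : ι → FractionRing R} {g : ι → L}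
    (h : ∀ i ∈ s, EvalsTo φ (f i) (g i)) : EvalsTo φ (∏ i ∈ s, f i) (∏ i ∈ s, g i) := by
  classical
  induction s using Finset.induction_on with
  | empty => simpa using one φ
  | insert a s ha ih =>
    rw [Finset.prod_insert ha, Finset.prod_insert ha]
    exact (h a (by simp)).mul (ih fun i hi => h i (by simp [hi]))

theorem qPoch {q : FractionRing R} {q' : L} (hx : EvalsTo φ x v) (hq : EvalsTo φ q q') (n : ℕ) :
    EvalsTo φ (qPoch x q n) (_root_.qPoch v q' n) :=
  prod fun i _ => (one φ).sub (hx.mul (hq.pow i))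

theorem qInt {q : FractionRing R} {q' : L} (hq : EvalsTo φ q q') (h1 : 1 - q' ≠ 0) (s : ℕ) :
    EvalsTo φ (qInt q s) (_root_.qInt q' s) :=
  ((one φ).sub (hq.pow s)).div ((one φ).sub hq) h1

theorem multiSum {f : ℕ → FractionRing R} {g : ℕ → L} {m N : ℕ}
    (h : ∀ k ≤ N, EvalsTo φ (f k) (g k)) :
    EvalsTo φ (multiSum m N f) (_root_.multiSum m N g) := by
  refine sum fun i hi => prod fun j _ => h _ ?_
  simp only [Finset.mem_filter, Fintype.mem_piFinset, Finset.mem_range] at hi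
  have := hi.1 j
  omega

end EvalsTo

/-- `x` is divisible by `p ^ e` in the ring of fractions without denominators killed by `φ`. -/
def PowDvd (φ : R →+* L) (p : R) (e : ℕ) (x : FractionRing R) : Prop :=
  ∃ z v, EvalsTo φ z v ∧ x = algebraMap R (FractionRing R) p ^ e * z

namespace PowDvd

variable {φ : R →+* L} {p : R} {x y : FractionRing R} {v : L} {e f : ℕ}

theorem zero : PowDvd φ p e 0 := ⟨0, 0, EvalsTo.zero φ, by simp⟩

theorem add (hx : PowDvd φ p e x) (hy : PowDvd φ p e y) : PowDvd φ p e (x + y) := by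
  obtain ⟨z, v, h, rfl⟩ := hx
  obtain ⟨z', v', h', rfl⟩ := hy
  exact ⟨z + z', _, h.add h', by ring⟩

theorem neg (hx : PowDvd φ p e x) : PowDvd φ p e (-x) := by
  obtain ⟨z, v, h, rfl⟩ := hx
  exact ⟨-z, _, h.neg, by ring⟩

theorem sub (hx : PowDvd φ p e x) (hy : PowDvd φ p e y) : PowDvd φ p e (x - y) := by
  simpa [sub_eq_add_neg] using hx.add hy.neg

theorem sum {ι : Type*} {s : Finset ι} {g : ι → FractionRing R}
    (h : ∀ i ∈ s, PowDvd φ p e (g i)) : PowDvd φ p e (∑ i ∈ s, g i) := by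
  classical
  induction s using Finset.induction_on with
  | empty => simpa using zero
  | insert a s ha ih =>
    rw [Finset.sum_insert ha]
    exact (h a (by simp)).add (ih fun i hi => h i (by simp [hi]))

theorem of_evalsTo (hx : EvalsTo φ x v) : PowDvd φ p 0 x := ⟨x, v, hx, by simp⟩

theorem mul (hx : PowDvd φ p e x) (hy : PowDvd φ p f y) : PowDvd φ p (e + f) (x * y) := by
  obtain ⟨z, v, h, rfl⟩ := hx
  obtain ⟨z', v', h', rfl⟩ := hy
  exact ⟨z * z', _, h.mul h', by ring⟩

theorem mul_evalsTo (hx : PowDvd φ p e x) (hy : EvalsTo φ y v) : PowDvd φ p e (x * y) :=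
  hx.mul (of_evalsTo hy)

theorem mono (hx : PowDvd φ p e x) (h : f ≤ e) : PowDvd φ p f x := by
  obtain ⟨z, v, h', rfl⟩ := hx
  obtain ⟨g, rfl⟩ := Nat.exists_eq_add_of_le h
  exact ⟨_, _, ((EvalsTo.of_algebraMap φ p).pow g).mul h', by ring⟩

theorem pow (hx : PowDvd φ p e x) (n : ℕ) : PowDvd φ p (e * n) (x ^ n) := by
  obtain ⟨z, v, h, rfl⟩ := hx
  exact ⟨_, _, h.pow n, by rw [mul_pow, ← pow_mul]⟩

/-- Turns vanishing in the residue field into one factor p; higher powers come from multiplying such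
factors. -/
theorem of_evalsTo_zero (hφ : ∀ a, φ a = 0 → p ∣ a) (hx : EvalsTo φ x 0) : PowDvd φ p 1 x := by
  obtain ⟨N, D, hD, h1, h2⟩ := hx
  obtain ⟨c, rfl⟩ := hφ N (by rw [← h2, zero_mul])
  have hD0 : algebraMap R (FractionRing R) D ≠ 0 := by
    rw [Ne, IsFractionRing.to_map_eq_zero_iff]
    rintro rfl
    simp at hD
  refine ⟨_, _, (EvalsTo.of_algebraMap φ c).div (EvalsTo.of_algebraMap φ D) hD, ?_⟩
  rw [pow_one, ← mul_div_assoc, eq_div_iff hD0, h1, map_mul]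

theorem evalsTo_zero (hp : φ p = 0) (he : e ≠ 0) (hx : PowDvd φ p e x) : EvalsTo φ x 0 := by
  obtain ⟨z, v, h, rfl⟩ := hx
  simpa [hp, he] using ((EvalsTo.of_algebraMap φ p).pow e).mul h

theorem fracCongr [DecompositionMonoid R] (hp : Irreducible p) (hφ : φ p = 0)
    {A B : FractionRing R} (h : PowDvd φ p e (A - B)) : FracCongr (p ^ e) A B := by
  obtain ⟨z, v, ⟨N, D, hD, h1, h2⟩, h⟩ := h
  have hD0 : D ≠ 0 := by
    rintro rfl
    simp at hD
  have hD0' : algebraMap R (FractionRing R) D ≠ 0 := by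
    rwa [Ne, IsFractionRing.to_map_eq_zero_iff]
  refine ⟨N, D, hD0, ?_, ?_⟩
  · have : IsRelPrime p D := by
      rw [hp.isRelPrime_iff_not_dvd]
      rintro ⟨c, rfl⟩
      simp [hφ] at hD
    exact this.symm.pow_right
  · rw [h, eq_div_iff hD0', mul_assoc, h1, map_mul, map_pow]

end PowDvd

/-- In the reduced form N/D of A - B, each modulus divides N and is coprime to D; coprimality of the
moduli then lets their product divide N. -/
theorem FracCongr.mul_modulus [UniqueFactorizationMonoid R] {P Q : R} {A B : FractionRing R}
    (hPQ : IsRelPrime P Q) (h1 : FracCongr P A B) (h2 : FracCongr Q A B) :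
    FracCongr (P * Q) A B := by
  obtain ⟨N₁, D₁, hD₁, hr₁, e₁⟩ := h1
  obtain ⟨N₂, D₂, hD₂, hr₂, e₂⟩ := h2
  obtain ⟨N, D, hND, hx⟩ := IsFractionRing.exists_reduced_fraction R (K := FractionRing R) (A - B)
  have inj := IsFractionRing.injective R (FractionRing R)
  have hne : ∀ {a : R}, a ≠ 0 → algebraMap R (FractionRing R) a ≠ 0 := fun h => by
    rwa [Ne, IsFractionRing.to_map_eq_zero_iff]
  have hD0 : (D : R) ≠ 0 := nonZeroDivisors.coe_ne_zero D
  rw [IsFractionRing.mk'_eq_div] at hx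
  have key : ∀ {P' N' D' : R}, D' ≠ 0 → IsRelPrime D' P' →
      A - B = algebraMap R (FractionRing R) (P' * N') / algebraMap R (FractionRing R) D' →
      P' ∣ N ∧ IsRelPrime (D : R) P' := by
    intro P' N' D' h0 hr he
    rw [← hx, div_eq_div_iff (hne hD0) (hne h0), ← map_mul, ← map_mul] at he
    have he := inj he
    refine ⟨hr.symm.dvd_of_dvd_mul_right ⟨N' * D, by rw [he]; ring⟩, ?_⟩
    have : (D : R) ∣ D' := hND.symm.dvd_of_dvd_mul_left ⟨P' * N', by rw [he]; ring⟩
    exact hr.of_dvd_left this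
  obtain ⟨d1, r1⟩ := key hD₁ hr₁ e₁
  obtain ⟨d2, r2⟩ := key hD₂ hr₂ e₂
  obtain ⟨c, hc⟩ := hPQ.mul_dvd d1 d2
  exact ⟨c, D, hD0, r1.mul_right r2, by rw [← hx, hc]⟩

end Evaluation

/-! ### Splitting the multiple sum. -/

section MultiSum

variable {K : Type*} [Field K]

/-- The cube [0, M]^m lies inside the simplex because mM ≤ N, and the sum over a cube factors. The
set `s` is the rest of the simplex. -/
theorem multiSum_eq_pow_add {m M N : ℕ} (h : m * M ≤ N) (f : ℕ → K) :
    ∃ s : Finset (Fin m → ℕ), (∀ i ∈ s, (∀ j, i j ≤ N) ∧ ∃ j, M < i j) ∧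
      multiSum m N f = (∑ k ∈ Finset.range (M + 1), f k) ^ m + ∑ i ∈ s, ∏ j, f (i j) := by
  classical
  refine ⟨((Fintype.piFinset fun _ : Fin m => Finset.range (N + 1)).filter
    fun i => ∑ j, i j ≤ N).filter fun i => ∃ j, M < i j, ?_, ?_⟩
  · intro i hi
    simp only [Finset.mem_filter, Fintype.mem_piFinset, Finset.mem_range] at hi
    exact ⟨fun j => Nat.lt_succ_iff.1 (hi.1.1 j), hi.2⟩
  · rw [multiSum, ← Finset.sum_filter_not_add_sum_filter _ (fun i : Fin m → ℕ => ∃ j, M < i j)]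
    congr 1
    rw [show (∑ k ∈ Finset.range (M + 1), f k) ^ m =
      ∏ _j : Fin m, ∑ k ∈ Finset.range (M + 1), f k by simp, Finset.prod_univ_sum]
    refine Finset.sum_congr ?_ fun _ _ => rfl
    ext i
    simp only [Finset.mem_filter, Fintype.mem_piFinset, Finset.mem_range, not_exists, not_lt,
      Nat.lt_succ_iff]
    refine ⟨fun hi => hi.2, fun hi => ?_⟩
    have hs : ∑ j, i j ≤ N := by
      calc ∑ j, i j ≤ ∑ _j : Fin m, M := Finset.sum_le_sum fun j _ => hi j
        _ = m * M := by simp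
        _ ≤ N := h
    exact ⟨⟨fun j => (Finset.single_le_sum (fun _ _ => Nat.zero_le _) (Finset.mem_univ j)).trans hs,
      hs⟩, hi⟩

end MultiSum

/-! ### Primality of the factors of the modulus, and residue fields. -/

section Primes

/-- After exchanging the variables the polynomial is monic and linear in a. -/
theorem polyA_sub_pow_prime (n : ℕ) : Prime (polyA - polyQ ^ n) := by
  have h : Bivariate.swap (X - C (X ^ n) : ℚ[X][X]) = polyA - polyQ ^ n := by
    rw [map_sub, C_pow, map_pow, Bivariate.swap_X, Bivariate.swap_Y, polyA, polyQ]
  rw [← h]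
  exact (MulEquiv.prime_iff (Bivariate.swap (R := ℚ))).2 (prime_X_sub_C _)

theorem one_sub_polyA_mul_pow_prime (n : ℕ) : Prime (1 - polyA * polyQ ^ n) := by
  have h : Bivariate.swap (C (-(X ^ n)) * X + C 1 : ℚ[X][X]) = 1 - polyA * polyQ ^ n := by
    rw [map_add, map_mul, C_neg, map_neg, C_pow, map_pow, Bivariate.swap_X, Bivariate.swap_Y,
      C_1, map_one, polyA, polyQ]
    ring
  rw [← h]
  refine (MulEquiv.prime_iff (Bivariate.swap (R := ℚ))).2 (Irreducible.prime ?_)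
  exact irreducible_C_mul_X_add_C (by simp) isRelPrime_one_right

/-- After exchanging the variables this is a constant in ℚ[q][a], so irreducibility over ℚ suffices.
-/
theorem cyclotomic_polynomial_prime {n : ℕ} (hn : 0 < n) : Prime (cyclotomic n ℚ[X]) := by
  have h : Bivariate.swap (C (cyclotomic n ℚ) : ℚ[X][X]) = cyclotomic n ℚ[X] := by
    rw [Bivariate.swap_C, map_cyclotomic]
  rw [← h]
  exact (MulEquiv.prime_iff (Bivariate.swap (R := ℚ))).2
    (prime_C_iff.2 (cyclotomic.irreducible_rat hn).prime)

theorem exists_residueField {R : Type} [CommRing R] {p : R} (hp : Prime p) :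
    ∃ (L : Type) (_ : Field L) (φ : R →+* L), ∀ x, φ x = 0 ↔ p ∣ x := by
  have : (Ideal.span {p}).IsPrime := (Ideal.span_singleton_prime hp.ne_zero).2 hp
  refine ⟨FractionRing (R ⧸ Ideal.span {p}), inferInstance,
    (algebraMap (R ⧸ Ideal.span {p}) _).comp (Ideal.Quotient.mk _), fun x => ?_⟩
  rw [RingHom.comp_apply, IsFractionRing.to_map_eq_zero_iff, Ideal.Quotient.eq_zero_iff_mem,
    Ideal.mem_span_singleton]

/-- Evaluation of polynomials in `a` and `q` at a point. -/
noncomputable def evalAQ (a q : ℂ) : PolyAQ →+* ℂ :=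
  eval₂RingHom (eval₂RingHom (algebraMap ℚ ℂ) a) q

@[simp] theorem evalAQ_polyA (a q : ℂ) : evalAQ a q polyA = a := by simp [evalAQ, polyA]

@[simp] theorem evalAQ_polyQ (a q : ℂ) : evalAQ a q polyQ = q := by simp [evalAQ, polyQ]

theorem evalAQ_cyclotomic (a q : ℂ) (n : ℕ) :
    evalAQ a q (cyclotomic n ℚ[X]) = (cyclotomic n ℂ).eval q := by
  rw [evalAQ, coe_eval₂RingHom, ← eval_map, map_cyclotomic]

end Primes

/-! ### Control of the denominators. -/

section NonVanishing

/-- The factors occurring in the denominators of the terms with index below `n` do not vanish. -/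
structure NonVanishing {L : Type*} [Field L] (d r n M : ℕ) (a q : L) : Prop where
  q_ne_zero : q ≠ 0
  a_ne_zero : a ≠ 0
  q_ne_one : 1 - q ≠ 0
  a_ne_one : 1 - a ≠ 0
  pow_ne_one : ∀ i, i + 1 < n → q ^ d * (q ^ d) ^ i ≠ 1
  mul_pow_ne_one : ∀ i, i + 1 < n → a * q ^ d * (q ^ d) ^ i ≠ 1
  div_pow_ne_one : ∀ i, i + 1 < n → q ^ d / a * (q ^ d) ^ i ≠ 1
  sq_pow_ne_one : ∀ i < M, (q ^ r) ^ 2 * (q ^ d) ^ i ≠ 1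

/-- A polynomial killed by φ is killed by ψ, so it is enough to test the denominators at one
convenient point ψ of the curve cut out by φ. -/
theorem NonVanishing.of_ker_le {R L K : Type*} [CommRing R] [Field L] [Field K] {φ : R →+* L}
    {ψ : R →+* K} (h : ∀ x, φ x = 0 → ψ x = 0) {d r n M : ℕ} {a q : R}
    (hψ : NonVanishing d r n M (ψ a) (ψ q)) : NonVanishing d r n M (φ a) (φ q) := by
  have ha : φ a ≠ 0 := fun h0 => hψ.a_ne_zero (h _ h0)
  constructor
  · exact fun h0 => hψ.q_ne_zero (h _ h0)
  · exact ha
  · intro h0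
    have := h (1 - q) (by simpa using h0)
    exact hψ.q_ne_one (by simpa using this)
  · intro h0
    have := h (1 - a) (by simpa using h0)
    exact hψ.a_ne_one (by simpa using this)
  · intro i hi h0
    have := h (q ^ d * (q ^ d) ^ i - 1) (by simp [h0])
    exact hψ.pow_ne_one i hi (sub_eq_zero.1 (by simpa using this))
  · intro i hi h0
    have := h (a * q ^ d * (q ^ d) ^ i - 1) (by simp [h0])
    exact hψ.mul_pow_ne_one i hi (sub_eq_zero.1 (by simpa using this))
  · intro i hi h0
    rw [div_mul_eq_mul_div, div_eq_one_iff_eq ha] at h0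
    have := h (q ^ d * (q ^ d) ^ i - a) (by simp [h0])
    apply hψ.div_pow_ne_one i hi
    rw [div_mul_eq_mul_div, div_eq_one_iff_eq hψ.a_ne_zero]
    exact sub_eq_zero.1 (by simpa using this)
  · intro i hi h0
    have := h ((q ^ r) ^ 2 * (q ^ d) ^ i - 1) (by simp [h0])
    exact hψ.sq_pow_ne_one i hi (sub_eq_zero.1 (by simpa using this))

end NonVanishing

/-! ### Specialisation of the hypergeometric terms. -/

section Terms

variable {R L : Type*} [CommRing R] [IsDomain R] [Field L] {φ : R →+* L}
  {A q a b : FractionRing R} {A' q' a' b' : L}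

theorem wTerm_evalsTo (hA : EvalsTo φ A A') (hq : EvalsTo φ q q') (ha : EvalsTo φ a a')
    (hb : EvalsTo φ b b') (hA0 : A' ≠ 0) (ha0 : a' ≠ 0) (hb0 : b' ≠ 0) {k : ℕ}
    (h1 : qPoch q' q' k ≠ 0) (h2 : qPoch (q' / a') q' k ≠ 0) (h3 : qPoch (a' * q') q' k ≠ 0)
    (h4 : qPoch (q' / b') q' k ≠ 0) (h5 : qPoch (b' * q') q' k ≠ 0) :
    EvalsTo φ (wTerm A q a b k) (wTerm A' q' a' b' k) :=
  (((EvalsTo.one φ).sub (hA.mul (hq.pow _))).mul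
    (((((hA.qPoch hq k).pow 2).mul (((ha.mul hA).qPoch hq k).mul ((hA.div ha ha0).qPoch hq k))).mul
      (((hb.mul hA).qPoch hq k).mul ((hA.div hb hb0).qPoch hq k))).div
      ((((hq.qPoch hq k).pow 2).mul (((hq.div ha ha0).qPoch hq k).mul
        ((ha.mul hq).qPoch hq k))).mul (((hq.div hb hb0).qPoch hq k).mul
          ((hb.mul hq).qPoch hq k)))
      (mul_ne_zero (mul_ne_zero (pow_ne_zero _ h1) (mul_ne_zero h2 h3)) (mul_ne_zero h4 h5)))).mul
    (((hq.pow 2).div (hA.pow 3) (pow_ne_zero _ hA0)).pow k)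

theorem balTerm_evalsTo (hA : EvalsTo φ A A') (hq : EvalsTo φ q q') (ha : EvalsTo φ a a')
    (hb : EvalsTo φ b b') (hA0 : A' ≠ 0) (ha0 : a' ≠ 0) (hb0 : b' ≠ 0) {k : ℕ}
    (h1 : qPoch q' q' k ≠ 0) (h2 : qPoch (q' / a') q' k ≠ 0) (h3 : qPoch (a' * q') q' k ≠ 0)
    (h4 : qPoch (A' ^ 2) q' k ≠ 0) :
    EvalsTo φ (balTerm A q a b k) (balTerm A' q' a' b' k) :=
  ((((hA.qPoch hq k).mul (((hb.mul hA).qPoch hq k).mul ((hA.div hb hb0).qPoch hq k))).mul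
    ((hq.div hA hA0).qPoch hq k)).div
    (((((ha.mul hq).qPoch hq k).mul ((hq.div ha ha0).qPoch hq k)).mul (hq.qPoch hq k)).mul
      ((hA.pow 2).qPoch hq k))
    (mul_ne_zero (mul_ne_zero (mul_ne_zero h3 h2) h1) h4)).mul (hq.pow k)

end Terms

/-! ### Both sides in hypergeometric notation. -/

section Sides

variable {K : Type*} [Field K]

/-- The summand of the multiple sum in terms of the very-well-poised term. -/
theorem qLambda_eq {q : K} (hq : q ≠ 0) (d r : ℕ) (a : K) (k : ℕ) :
    qLambda d r a q k = wTerm (q ^ r) (q ^ d) a 1 k / (1 - q) := by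
  have h1 : q ^ ((2 * (d : ℤ) - 3 * (r : ℤ)) * (k : ℤ)) = ((q ^ d) ^ 2 / (q ^ r) ^ 3) ^ k := by
    rw [zpow_mul, zpow_sub₀ hq, zpow_natCast]
    congr 2
    · rw [mul_comm, zpow_mul]; norm_cast
    · rw [mul_comm, zpow_mul]; norm_cast
  have h2 : 1 - q ^ r * (q ^ d) ^ (2 * k) = 1 - q ^ (2 * d * k + r) := by ring
  rw [qLambda, wTerm, h1, h2, qInt]
  simp only [one_mul, div_one]
  ring

/-- The prefactor `[n] q ^ (-r M) (q ^ (2 r); q ^ d)_M / (q ^ d; q ^ d)_M`. -/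
noncomputable def prefactor (d r n M : ℕ) (q : K) : K :=
  qInt q n * ((q ^ r)⁻¹ ^ M * (qPoch ((q ^ r) ^ 2) (q ^ d) M / qPoch (q ^ d) (q ^ d) M))

/-- The sum of the balanced series up to index `M`. -/
noncomputable def balSum (d r M : ℕ) (a b q : K) : K :=
  ∑ k ∈ Finset.range (M + 1), balTerm (q ^ r) (q ^ d) a b k

/-- The right-hand side of the congruence, with `M = (n - r) / d`. -/
noncomputable def rightSide (d r n m M : ℕ) (a q : K) : K :=
  prefactor d r n M q ^ m *
    ((1 - q ^ n) ^ 2 * (1 + a ^ 2 - a * q ^ n) / (1 - a) ^ 2 * balSum d r M 1 a q ^ m -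
      (2 - q ^ n) * (1 - a * q ^ n) * (a - q ^ n) / (1 - a) ^ 2 * balSum d r M a 1 q ^ m)

theorem rightSide_eq {d r n m M : ℕ} (hd : 0 < d) (hM : r + d * M = n) {q : K} (hq : q ≠ 0)
    (a : K) :
    qInt q n ^ m * q ^ (((m : ℤ) * (r : ℤ) * ((r : ℤ) - (n : ℤ))) / (d : ℤ)) *
          ((1 - q ^ n) ^ 2 * (1 + a ^ 2 - a * q ^ n) / (1 - a) ^ 2) *
          (qPoch (q ^ (2 * r)) (q ^ d) ((n - r) / d) ^ m / qPoch (q ^ d) (q ^ d) ((n - r) / d) ^ m) *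
          (∑ k ∈ Finset.range ((n - r) / d + 1),
            (qPoch (a * q ^ r) (q ^ d) k * qPoch (q ^ r / a) (q ^ d) k * qPoch (q ^ r) (q ^ d) k *
                qPoch (q ^ ((d : ℤ) - (r : ℤ))) (q ^ d) k) /
              (qPoch (q ^ d) (q ^ d) k ^ 3 * qPoch (q ^ (2 * r)) (q ^ d) k) *
              q ^ (d * k)) ^ m
        - qInt q n ^ m * q ^ (((m : ℤ) * (r : ℤ) * ((r : ℤ) - (n : ℤ))) / (d : ℤ)) *
          ((2 - q ^ n) * (1 - a * q ^ n) * (a - q ^ n) / (1 - a) ^ 2) *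
          (qPoch (q ^ (2 * r)) (q ^ d) ((n - r) / d) ^ m / qPoch (q ^ d) (q ^ d) ((n - r) / d) ^ m) *
          (∑ k ∈ Finset.range ((n - r) / d + 1),
            (qPoch (q ^ r) (q ^ d) k ^ 3 * qPoch (q ^ ((d : ℤ) - (r : ℤ))) (q ^ d) k) /
              (qPoch (a * q ^ d) (q ^ d) k * qPoch (q ^ d / a) (q ^ d) k *
                qPoch (q ^ d) (q ^ d) k * qPoch (q ^ (2 * r)) (q ^ d) k) *
              q ^ (d * k)) ^ m = rightSide d r n m M a q := by
  have hM' : (n - r) / d = M := by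
    rw [← hM, Nat.add_sub_cancel_left, Nat.mul_div_cancel_left _ hd]
  -- The integer division is exact because r - n = -dM.
  have e1 : q ^ (((m : ℤ) * (r : ℤ) * ((r : ℤ) - (n : ℤ))) / (d : ℤ)) =
      ((q ^ r)⁻¹ ^ M) ^ m := by
    have : (m : ℤ) * (r : ℤ) * ((r : ℤ) - (n : ℤ)) = (d : ℤ) * -((r * M * m : ℕ) : ℤ) := by
      rw [← hM]; push_cast; ring
    rw [this, Int.mul_ediv_cancel_left _ (by exact_mod_cast hd.ne'), zpow_neg, zpow_natCast,
      pow_mul, pow_mul, inv_pow, inv_pow]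
  have e2 : q ^ ((d : ℤ) - (r : ℤ)) = q ^ d / q ^ r := by
    rw [zpow_sub₀ hq, zpow_natCast, zpow_natCast]
  have e3 : q ^ (2 * r) = (q ^ r) ^ 2 := by ring
  rw [hM', e1, e2, e3, rightSide, balSum, balSum, prefactor, mul_pow, mul_pow, div_pow]
  have s1 : ∀ k ∈ Finset.range (M + 1),
      (qPoch (a * q ^ r) (q ^ d) k * qPoch (q ^ r / a) (q ^ d) k * qPoch (q ^ r) (q ^ d) k *
                qPoch (q ^ d / q ^ r) (q ^ d) k) /
              (qPoch (q ^ d) (q ^ d) k ^ 3 * qPoch ((q ^ r) ^ 2) (q ^ d) k) *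
              q ^ (d * k) = balTerm (q ^ r) (q ^ d) 1 a k := by
    intro k _
    rw [balTerm, one_mul, div_one, pow_mul]
    congr 2 <;> ring
  have s2 : ∀ k ∈ Finset.range (M + 1),
      (qPoch (q ^ r) (q ^ d) k ^ 3 * qPoch (q ^ d / q ^ r) (q ^ d) k) /
              (qPoch (a * q ^ d) (q ^ d) k * qPoch (q ^ d / a) (q ^ d) k *
                qPoch (q ^ d) (q ^ d) k * qPoch ((q ^ r) ^ 2) (q ^ d) k) *
              q ^ (d * k) = balTerm (q ^ r) (q ^ d) a 1 k := by
    intro k _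
    rw [balTerm, one_mul, div_one, pow_mul]
    congr 2; ring
  rw [Finset.sum_congr rfl s1, Finset.sum_congr rfl s2]
  ring

end Sides

/-! ### Exact identities at a = q^(±n), and the vanishing first-order sum. -/

section FieldIdentities

variable {K : Type*} [Field K]

theorem pow_ne_pow_of_lt {q : K} (hq0 : q ≠ 0) (hq : ∀ s, 0 < s → q ^ s ≠ 1) {s t : ℕ}
    (h : s < t) : q ^ s ≠ q ^ t := by
  intro h'
  obtain ⟨u, rfl⟩ := Nat.exists_eq_add_of_lt h
  apply hq (u + 1) u.succ_pos
  have : q ^ s * q ^ (u + 1) = q ^ s * 1 := by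
    rw [← pow_add, mul_one]; exact h'.symm
  exact mul_left_cancel₀ (pow_ne_zero s hq0) this

/-- Watson with A = q^r in base q^d; its factor 1 - q^n divided by 1 - q becomes [n]. -/
theorem sum_wTerm_eq_prefactor_mul_balSum {d r n M : ℕ} (hd : 0 < d) (hr : 0 < r)
    (hM : r + d * M = n) {a q : K} (hq0 : q ≠ 0) (ha0 : a ≠ 0) (hq : ∀ s, 0 < s → q ^ s ≠ 1)
    (ha : ∀ i < M, a * q ^ d * (q ^ d) ^ i ≠ 1) (ha' : ∀ i < M, q ^ d / a * (q ^ d) ^ i ≠ 1) :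
    ∑ k ∈ Finset.range (M + 1), wTerm (q ^ r) (q ^ d) a (q ^ n) k / (1 - q) =
      prefactor d r n M q * balSum d r M a (q ^ n) q := by
  have hx : q ^ n = q ^ r * (q ^ d) ^ M := by rw [← hM]; ring
  rw [← Finset.sum_div, hx, watson (pow_ne_zero _ hq0) (pow_ne_zero _ hq0) ha0
    (fun i => ?_) (fun i => ?_) (fun i hi => ?_) ha ha' (fun i hi => ?_), ← hx]
  · rw [prefactor, balSum, qInt]; ring
  · rw [← pow_mul, ← pow_add]; exact hq _ (by omega)
  · rw [← pow_mul, ← pow_add]; exact hq _ (by omega)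
  · rw [← pow_mul, ← pow_mul, ← pow_add]; exact hq _ (by omega)
  · rw [← hx, ← pow_mul, div_mul_eq_mul_div, ← pow_add, Ne, div_eq_one_iff_eq (pow_ne_zero _ hq0)]
    refine pow_ne_pow_of_lt hq0 hq ?_
    rw [← hM]
    have : d * (i + 1) ≤ d * M := Nat.mul_le_mul_left d hi
    have h2 : d * (i + 1) = d + d * i := by ring
    omega

/-- The term is symmetric under a ↔ b and a → 1/a, so a plays Watson's terminating parameter and 1
the free one. -/
theorem sum_qLambda_eq {d r n M : ℕ} (hd : 0 < d) (hr : 0 < r) (hM : r + d * M = n)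
    {a q : K} (hq0 : q ≠ 0) (hq : ∀ s, 0 < s → q ^ s ≠ 1) (hx : a = q ^ n ∨ a = (q ^ n)⁻¹) :
    ∑ k ∈ Finset.range (M + 1), qLambda d r a q k =
      prefactor d r n M q * balSum d r M 1 a q := by
  have h := sum_wTerm_eq_prefactor_mul_balSum hd hr hM hq0 one_ne_zero hq
    (fun i _ => by rw [one_mul, ← pow_mul, ← pow_add]; exact hq _ (by omega))
    (fun i _ => by rw [div_one, ← pow_mul, ← pow_add]; exact hq _ (by omega))
  rcases hx with rfl | rfl
  · rw [← h]
    exact Finset.sum_congr rfl fun k _ => by rw [qLambda_eq hq0, wTerm_swap]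
  · simp only [balSum, balTerm_inv_right] at h ⊢
    rw [← h]
    exact Finset.sum_congr rfl fun k _ => by rw [qLambda_eq hq0, wTerm_inv, wTerm_swap]

/-- Beyond M one of the factors (aq^r)_k, (q^r/a)_k vanishes, so the multiple sum is exactly a
power. -/
theorem multiSum_qLambda_eq_rightSide {d r n m M : ℕ} (hd : 0 < d) (hr : 0 < r)
    (hM : r + d * M = n) (hmM : m * M ≤ n - 1) {a q : K} (hq0 : q ≠ 0)
    (hq : ∀ s, 0 < s → q ^ s ≠ 1) (hx : a = q ^ n ∨ a = (q ^ n)⁻¹) :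
    multiSum m (n - 1) (qLambda d r a q) = rightSide d r n m M a q := by
  obtain ⟨s, hs, h⟩ := multiSum_eq_pow_add hmM (qLambda d r a q)
  have hn0 : q ^ n ≠ 0 := pow_ne_zero _ hq0
  have hx1 : 1 - q ^ n ≠ 0 := sub_ne_zero.2 (hq n (by omega)).symm
  have hxx : q ^ r * (q ^ d) ^ M = q ^ n := by rw [← hM]; ring
  have h0 : ∀ k, M < k → qLambda d r a q k = 0 := by
    intro k hk
    rcases hx with rfl | rfl
    · have : qPoch (q ^ r / q ^ n) (q ^ d) k = 0 :=
        qPoch_eq_zero hk (by rw [div_mul_eq_mul_div, hxx, div_self hn0])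
      simp [qLambda, this]
    · have : qPoch ((q ^ n)⁻¹ * q ^ r) (q ^ d) k = 0 :=
        qPoch_eq_zero hk (by rw [mul_assoc, hxx, inv_mul_cancel₀ hn0])
      simp [qLambda, this]
  have hrest : ∑ i ∈ s, ∏ j, qLambda d r a q (i j) = 0 := by
    refine Finset.sum_eq_zero fun i hi => ?_
    obtain ⟨j, hj⟩ := (hs i hi).2
    exact Finset.prod_eq_zero (Finset.mem_univ j) (h0 _ hj)
  have e1 : (1 - q ^ n) ^ 2 * (1 + a ^ 2 - a * q ^ n) / (1 - a) ^ 2 = 1 := by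
    rcases hx with rfl | rfl
    · rw [show 1 + (q ^ n) ^ 2 - q ^ n * q ^ n = 1 by ring, mul_one]
      exact div_self (pow_ne_zero _ hx1)
    · rw [inv_mul_cancel₀ hn0, show 1 - (q ^ n)⁻¹ = -((q ^ n)⁻¹ * (1 - q ^ n)) by
        rw [mul_sub, inv_mul_cancel₀ hn0]; ring]
      field_simp
      ring
  have e2 : (2 - q ^ n) * (1 - a * q ^ n) * (a - q ^ n) / (1 - a) ^ 2 = 0 := by
    rcases hx with rfl | rfl
    · simp
    · rw [inv_mul_cancel₀ hn0]; simp
  rw [h, hrest, sum_qLambda_eq hd hr hM hq0 hq hx, rightSide, e1, e2]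
  ring

/-- The logarithmic derivative of the factors of the very-well-poised term depending on `b`. -/
def logDerivSum (A q : K) (k : ℕ) : K :=
  ∑ j ∈ Finset.range k, (q * q ^ j / (1 - q * q ^ j) ^ 2 - A * q ^ j / (1 - A * q ^ j) ^ 2)

/-- The function x/(1 - x)^2 is invariant under x → 1/x, and A q^t is the inverse of a positive
power of q. With G the partial sums of `g`, this gives H_i = G(i) + G(j) - G(k + l) for i + j = k +
l, symmetric in i and j. -/
theorem logDerivSum_reflect {A q : K} {k l : ℕ} (h : A * q ^ (k + l) = 1) (hq0 : q ≠ 0)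
    (hq : ∀ i < k + l, q * q ^ i ≠ 1) : logDerivSum A q l = logDerivSum A q k := by
  have hA0 : A ≠ 0 := left_ne_zero_of_mul (h ▸ one_ne_zero)
  let g : ℕ → K := fun i => q * q ^ i / (1 - q * q ^ i) ^ 2
  have key : ∀ i j, i + j = k + l → logDerivSum A q i =
      ∑ t ∈ Finset.range i, g t + ∑ t ∈ Finset.range j, g t - ∑ t ∈ Finset.range (k + l), g t := by
    intro i j hij
    have e : ∀ t ∈ Finset.range i, A * q ^ t / (1 - A * q ^ t) ^ 2 = g (j + (i - 1 - t)) := by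
      intro t ht
      rw [Finset.mem_range] at ht
      have h1 : A * q ^ t = (q * q ^ (j + (i - 1 - t)))⁻¹ := by
        refine eq_inv_of_mul_eq_one_left ?_
        rw [← h, ← hij, show i + j = t + (1 + (j + (i - 1 - t))) by omega]
        ring
      have h2 : 1 - q * q ^ (j + (i - 1 - t)) ≠ 0 :=
        sub_ne_zero.2 (hq (j + (i - 1 - t)) (by omega)).symm
      have h3 : q * q ^ (j + (i - 1 - t)) ≠ 0 := by positivity
      simp only [g]
      rw [h1]
      generalize q * q ^ (j + (i - 1 - t)) = w at *
      rw [show 1 - w⁻¹ = -(w⁻¹ * (1 - w)) by rw [mul_sub, inv_mul_cancel₀ h3]; ring]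
      field_simp
    rw [logDerivSum, Finset.sum_sub_distrib, Finset.sum_congr rfl e,
      Finset.sum_range_reflect (fun t => g (j + t)), ← hij, add_comm i j,
      Finset.sum_range_add]
    simp only [g]
    ring
  rw [key l k (add_comm l k), key k l rfl, add_comm (∑ t ∈ Finset.range l, g t)]

/-- An odd factor times an even one under k → M - k: the sum equals its own negative. -/
theorem sum_wTerm_mul_logDerivSum_eq_zero [CharZero K] {A q a : K} {M : ℕ} (h : A * q ^ M = 1)
    (hq0 : q ≠ 0) (ha0 : a ≠ 0) (hq : ∀ i < M, q * q ^ i ≠ 1)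
    (ha : ∀ i < M, a * q * q ^ i ≠ 1) (ha' : ∀ i < M, q / a * q ^ i ≠ 1) :
    ∑ k ∈ Finset.range (M + 1), wTerm A q a 1 k * logDerivSum A q k = 0 := by
  have h1 := Finset.sum_range_reflect (fun k => wTerm A q a 1 k * logDerivSum A q k) (M + 1)
  have h2 : ∑ j ∈ Finset.range (M + 1), wTerm A q a 1 (M + 1 - 1 - j) *
        logDerivSum A q (M + 1 - 1 - j) =
      ∑ k ∈ Finset.range (M + 1), -(wTerm A q a 1 k * logDerivSum A q k) := by
    refine Finset.sum_congr rfl fun k hk => ?_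
    rw [Finset.mem_range] at hk
    have hkl : k + (M + 1 - 1 - k) = M := by omega
    rw [← hkl] at h hq ha ha'
    rw [wTerm_reflect h hq0 ha0 hq ha ha', logDerivSum_reflect h hq0 hq]
    ring
  rw [h2, Finset.sum_neg_distrib] at h1
  exact self_eq_neg.1 h1.symm

end FieldIdentities

/-! ### Expansion in b around 1, to the order of the modulus. -/

section Expansion

variable {R L : Type*} [CommRing R] [IsDomain R] [Field L] {φ : R →+* L} {p : R}
  {A q a b x y z : FractionRing R} {A' q' a' v w : L} {e f m : ℕ}

/-- The factors of the very-well-poised term depending on `b`. -/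
def bRatio {K : Type*} [Field K] (A q b : K) (k : ℕ) : K :=
  (qPoch (b * A) q k * qPoch (A / b) q k) / (qPoch (q / b) q k * qPoch (b * q) q k)

/-- The factors of the very-well-poised term not depending on `b`. -/
def wCoeff {K : Type*} [Field K] (A q a : K) (k : ℕ) : K :=
  (1 - A * q ^ (2 * k)) *
    ((qPoch A q k ^ 2 * (qPoch (a * A) q k * qPoch (A / a) q k)) /
      (qPoch q q k ^ 2 * (qPoch (q / a) q k * qPoch (a * q) q k))) * (q ^ 2 / A ^ 3) ^ k

theorem wTerm_eq_wCoeff_mul_bRatio {K : Type*} [Field K] (A q a b : K) (k : ℕ) :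
    wTerm A q a b k = wCoeff A q a k * bRatio A q b k := by
  rw [wTerm, wCoeff, bRatio, mul_div_mul_comm]
  ring

theorem wCoeff_evalsTo (hA : EvalsTo φ A A') (hq : EvalsTo φ q q') (ha : EvalsTo φ a a')
    (hA0 : A' ≠ 0) (ha0 : a' ≠ 0) {k : ℕ}
    (h1 : qPoch q' q' k ≠ 0) (h2 : qPoch (q' / a') q' k ≠ 0) (h3 : qPoch (a' * q') q' k ≠ 0) :
    EvalsTo φ (wCoeff A q a k) (wCoeff A' q' a' k) :=
  (((EvalsTo.one φ).sub (hA.mul (hq.pow _))).mul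
    ((((hA.qPoch hq k).pow 2).mul (((ha.mul hA).qPoch hq k).mul ((hA.div ha ha0).qPoch hq k))).div
      (((hq.qPoch hq k).pow 2).mul (((hq.div ha ha0).qPoch hq k).mul ((ha.mul hq).qPoch hq k)))
      (mul_ne_zero (pow_ne_zero _ h1) (mul_ne_zero h2 h3)))).mul
    (((hq.pow 2).div (hA.pow 3) (pow_ne_zero _ hA0)).pow k)

theorem EvalsTo.ne_zero (hx : EvalsTo φ x v) (hv : v ≠ 0) : x ≠ 0 := by
  rintro rfl
  obtain ⟨N, D, hD, h1, h2⟩ := hx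
  rw [zero_mul, eq_comm, IsFractionRing.to_map_eq_zero_iff] at h1
  rw [h1, map_zero] at h2
  exact mul_ne_zero hv hD h2

theorem logDerivSum_evalsTo (hA : EvalsTo φ A A') (hq : EvalsTo φ q q') {k : ℕ}
    (h1 : ∀ i < k, q' * q' ^ i ≠ 1) (h2 : ∀ i < k, A' * q' ^ i ≠ 1) :
    EvalsTo φ (logDerivSum A q k) (logDerivSum A' q' k) := by
  refine EvalsTo.sum fun i hi => ?_
  rw [Finset.mem_range] at hi
  exact ((hq.mul (hq.pow i)).div (((EvalsTo.one φ).sub (hq.mul (hq.pow i))).pow 2)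
    (pow_ne_zero _ (sub_ne_zero.2 (h1 i hi).symm))).sub
    ((hA.mul (hq.pow i)).div (((EvalsTo.one φ).sub (hA.mul (hq.pow i))).pow 2)
    (pow_ne_zero _ (sub_ne_zero.2 (h2 i hi).symm)))

theorem bRatio_one_evalsTo (hA : EvalsTo φ A A') (hq : EvalsTo φ q q') {k : ℕ}
    (h1 : ∀ i < k, q' * q' ^ i ≠ 1) : EvalsTo φ (bRatio A q 1 k) (bRatio A' q' 1 k) := by
  have hne : qPoch q' q' k ≠ 0 := qPoch_ne_zero h1
  simp only [bRatio, one_mul, div_one]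
  exact ((hA.qPoch hq k).mul (hA.qPoch hq k)).div ((hq.qPoch hq k).mul (hq.qPoch hq k))
    (mul_ne_zero hne hne)

/-- First-order expansion of `bRatio` at `b = 1`. -/
theorem bRatio_sub_powDvd (hφ : φ p = 0) (hA : EvalsTo φ A A') (hq : EvalsTo φ q q') (hb : b ≠ 0)
    (hy : y = (1 - b) ^ 2 / b) (hyp : PowDvd φ p 2 y) (k : ℕ)
    (h1 : ∀ i < k, q' * q' ^ i ≠ 1) (h2 : ∀ i < k, A' * q' ^ i ≠ 1) :
    PowDvd φ p 4 (bRatio A q b k - bRatio A q 1 k * (1 + y * logDerivSum A q k)) := by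
  induction k with
  | zero => simpa [bRatio, logDerivSum] using PowDvd.zero
  | succ k ih =>
    have ih := ih (fun i hi => h1 i (by omega)) fun i hi => h2 i (by omega)
    have hH := logDerivSum_evalsTo hA hq (k := k) (fun i hi => h1 i (by omega))
      fun i hi => h2 i (by omega)
    have hρ := bRatio_one_evalsTo hA hq (k := k) (fun i hi => h1 i (by omega))
    have hy0 : EvalsTo φ y 0 := hyp.evalsTo_zero hφ two_ne_zero
    have hv1 := sub_ne_zero.2 (h1 k (by omega)).symm
    have hu1 := sub_ne_zero.2 (h2 k (by omega)).symm
    have hu := hA.mul (hq.pow k)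
    have hv := hq.mul (hq.pow k)
    have hsu : logDerivSum A q (k + 1) = logDerivSum A q k +
        (q * q ^ k / (1 - q * q ^ k) ^ 2 - A * q ^ k / (1 - A * q ^ k) ^ 2) := by
      rw [logDerivSum, Finset.sum_range_succ]; rfl
    have hstep : ∀ c : FractionRing R, bRatio A q c (k + 1) = bRatio A q c k *
        ((1 - c * A * q ^ k) * (1 - A / c * q ^ k) /
          ((1 - q / c * q ^ k) * (1 - c * q * q ^ k))) := by
      intro c
      simp only [bRatio, qPoch_succ]
      rw [div_mul_div_comm]
      ring
    -- A pair of factors with parameters b and 1/b depends on b only through y.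
    have hN : ∀ c : FractionRing R, (1 - b * c * q ^ k) * (1 - c / b * q ^ k) =
        (1 - c * q ^ k) ^ 2 - c * q ^ k * y := by
      intro c
      rw [hy]
      field_simp
      ring
    rw [hstep b, hstep 1, hsu, hN A, mul_comm (1 - q / b * q ^ k), hN q]
    simp only [one_mul, div_one]
    generalize A * q ^ k = u at *
    generalize q * q ^ k = t at *
    generalize A' * q' ^ k = u' at *
    generalize q' * q' ^ k = t' at *
    generalize bRatio A q 1 k = ρ at *
    generalize bRatio A q b k = σ at *
    generalize logDerivSum A q k = H at *
    have hU := ((EvalsTo.one φ).sub hu).pow 2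
    have hV := ((EvalsTo.one φ).sub hv).pow 2
    have hV' : (1 - t') ^ 2 ≠ 0 := pow_ne_zero _ hv1
    have hU' : (1 - u') ^ 2 ≠ 0 := pow_ne_zero _ hu1
    have hD := hV.sub (hv.mul hy0)
    have hD' : (1 - t') ^ 2 - t' * 0 ≠ 0 := by simpa using hV'
    have hf := (hU.sub (hu.mul hy0)).div hD hD'
    have hh := (hv.div hV hV').sub (hu.div hU hU')
    have hf1 := hU.div hV hV'
    have hg := (hv.mul ((hU.mul hv).sub (hu.mul hV))).div ((hV.pow 2).mul hD)
      (mul_ne_zero (pow_ne_zero 2 hV') hD')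
    have nU : (1 - u) ^ 2 ≠ 0 := hU.ne_zero hU'
    have nV : (1 - t) ^ 2 ≠ 0 := hV.ne_zero hV'
    have nD : (1 - t) ^ 2 - t * y ≠ 0 := hD.ne_zero hD'
    rw [← pow_two (1 - u), ← pow_two (1 - t)]
    generalize (1 - u) ^ 2 = U at *
    generalize (1 - t) ^ 2 = V at *
    -- The old error is multiplied by a regular factor, and the new error is a multiple of y^2,
    -- hence of p^4.
    have e : σ * ((U - u * y) / (V - t * y)) - ρ * (U / V) * (1 + y * (H + (t / V - u / U))) =
        (σ - ρ * (1 + y * H)) * ((U - u * y) / (V - t * y)) +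
        y * y * (ρ * ((1 + y * H) * (t * (U * t - u * V) / (V ^ 2 * (V - t * y))) +
          U / V * (H * (t / V - u / U)))) := by
      generalize hz : V - t * y = D at *
      field_simp
      rw [← hz]
      ring
    rw [e]
    exact (ih.mul_evalsTo hf).add ((hyp.mul hyp).mul_evalsTo
      (hρ.mul ((((EvalsTo.one φ).add (hy0.mul hH)).mul hg).add (hf1.mul (hH.mul hh)))))

theorem qPoch_mul_sub_powDvd (hφ : φ p = 0) (hA : EvalsTo φ A A') (hq : EvalsTo φ q q')
    (hb : b ≠ 0) (hy : y = (1 - b) ^ 2 / b) (hyp : PowDvd φ p 2 y) (k : ℕ) :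
    PowDvd φ p 2 (qPoch (b * A) q k * qPoch (A / b) q k - qPoch A q k * qPoch A q k) := by
  induction k with
  | zero => simpa using PowDvd.zero
  | succ k ih =>
    have hu := hA.mul (hq.pow k)
    have hy0 : EvalsTo φ y 0 := hyp.evalsTo_zero hφ two_ne_zero
    have hN : (1 - b * A * q ^ k) * (1 - A / b * q ^ k) =
        (1 - A * q ^ k) ^ 2 - A * q ^ k * y := by
      rw [hy]
      field_simp
      ring
    have e : qPoch (b * A) q (k + 1) * qPoch (A / b) q (k + 1) -
        qPoch A q (k + 1) * qPoch A q (k + 1) =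
        (qPoch (b * A) q k * qPoch (A / b) q k - qPoch A q k * qPoch A q k) *
          ((1 - A * q ^ k) ^ 2 - A * q ^ k * y) +
        y * (-(qPoch A q k * qPoch A q k * (A * q ^ k))) := by
      simp only [qPoch_succ]
      linear_combination (qPoch (b * A) q k * qPoch (A / b) q k) * hN
    rw [e]
    exact (ih.mul_evalsTo ((((EvalsTo.one φ).sub hu).pow 2).sub (hu.mul hy0))).add
      (hyp.mul_evalsTo (((hA.qPoch hq k).mul (hA.qPoch hq k)).mul hu).neg)

/-- The cofactor of x - y in x^m - y^m is homogeneous of degree m - 1 ≥ 1 in x and y, which supplies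
the extra factor p. -/
theorem pow_sub_pow_powDvd (hx : PowDvd φ p 1 x) (hy : PowDvd φ p 1 y)
    (hxy : PowDvd φ p e (x - y)) (hm : 2 ≤ m) : PowDvd φ p (e + 1) (x ^ m - y ^ m) := by
  have h1 : ∀ k : ℕ, PowDvd φ p e (x ^ k - y ^ k) := by
    intro k
    induction k with
    | zero => simpa using PowDvd.zero
    | succ k ih =>
      have e : x ^ (k + 1) - y ^ (k + 1) = x ^ k * (x - y) + y * (x ^ k - y ^ k) := by ring
      rw [e]
      exact (((hx.pow k).mul hxy).mono (by omega)).add ((hy.mul ih).mono (by omega))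
  obtain ⟨k, rfl⟩ := Nat.exists_eq_add_of_le hm
  have e : x ^ (2 + k) - y ^ (2 + k) = x ^ (k + 1) * (x - y) + y * (x ^ (k + 1) - y ^ (k + 1)) := by
    ring
  rw [e]
  exact (((hx.pow _).mul hxy).mono (by omega)).add ((hy.mul (h1 _)).mono (by omega))

theorem prod_powDvd {ι : Type*} {s : Finset ι} {g : ι → FractionRing R} {g' : ι → L}
    (hg : ∀ i ∈ s, EvalsTo φ (g i) (g' i)) {j : ι} (hj : j ∈ s) (h : PowDvd φ p e (g j)) :
    PowDvd φ p e (∏ i ∈ s, g i) := by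
  classical
  rw [← Finset.mul_prod_erase s g hj]
  exact h.mul_evalsTo (EvalsTo.prod fun i hi => hg i (Finset.mem_of_mem_erase hi))

end Expansion

/-! ### Specialisation of both sides of the congruence. -/

section Evaluations

variable {R L : Type*} [CommRing R] [IsDomain R] [Field L] {φ : R →+* L}
  {a q : FractionRing R} {a' q' : L} {d r n m M k : ℕ}

namespace NonVanishing

theorem qPoch_base (h : NonVanishing d r n M a' q') (hk : k < n) :
    qPoch (q' ^ d) (q' ^ d) k ≠ 0 := qPoch_ne_zero fun i _ => h.pow_ne_one i (by omega)

theorem qPoch_mul (h : NonVanishing d r n M a' q') (hk : k < n) :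
    qPoch (a' * q' ^ d) (q' ^ d) k ≠ 0 := qPoch_ne_zero fun i _ => h.mul_pow_ne_one i (by omega)

theorem qPoch_div (h : NonVanishing d r n M a' q') (hk : k < n) :
    qPoch (q' ^ d / a') (q' ^ d) k ≠ 0 := qPoch_ne_zero fun i _ => h.div_pow_ne_one i (by omega)

theorem qPoch_sq (h : NonVanishing d r n M a' q') (hk : k ≤ M) :
    qPoch ((q' ^ r) ^ 2) (q' ^ d) k ≠ 0 := qPoch_ne_zero fun i _ => h.sq_pow_ne_one i (by omega)

end NonVanishing

theorem wTerm_one_evalsTo (ha : EvalsTo φ a a') (hq : EvalsTo φ q q')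
    (h : NonVanishing d r n M a' q') (hk : k < n) :
    EvalsTo φ (wTerm (q ^ r) (q ^ d) a 1 k) (wTerm (q' ^ r) (q' ^ d) a' 1 k) :=
  wTerm_evalsTo (hq.pow r) (hq.pow d) ha (EvalsTo.one φ) (pow_ne_zero _ h.q_ne_zero) h.a_ne_zero
    one_ne_zero (h.qPoch_base hk) (h.qPoch_div hk) (h.qPoch_mul hk)
    (by rw [div_one]; exact h.qPoch_base hk) (by rw [one_mul]; exact h.qPoch_base hk)

theorem qLambda_evalsTo (ha : EvalsTo φ a a') (hq : EvalsTo φ q q')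
    (h : NonVanishing d r n M a' q') (hk : k < n) :
    EvalsTo φ (qLambda d r a q k) (qLambda d r a' q' k) := by
  rw [qLambda_eq (hq.ne_zero h.q_ne_zero), qLambda_eq h.q_ne_zero]
  exact (wTerm_one_evalsTo ha hq h hk).div ((EvalsTo.one φ).sub hq) h.q_ne_one

theorem prefactor_evalsTo (hq : EvalsTo φ q q') (h : NonVanishing d r n M a' q') (hM : M < n) :
    EvalsTo φ (prefactor d r n M q) (prefactor d r n M q') :=
  (hq.qInt h.q_ne_one n).mul
    ((((hq.pow r).inv (pow_ne_zero _ h.q_ne_zero)).pow M).mul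
      ((((hq.pow r).pow 2).qPoch (hq.pow d) M).div ((hq.pow d).qPoch (hq.pow d) M)
        (h.qPoch_base hM)))

theorem balSum_one_left_evalsTo (ha : EvalsTo φ a a') (hq : EvalsTo φ q q')
    (h : NonVanishing d r n M a' q') (hM : M < n) :
    EvalsTo φ (balSum d r M 1 a q) (balSum d r M 1 a' q') := by
  refine EvalsTo.sum fun k hk => ?_
  have hk : k ≤ M := Nat.lt_succ_iff.1 (Finset.mem_range.1 hk)
  exact balTerm_evalsTo (hq.pow r) (hq.pow d) (EvalsTo.one φ) ha (pow_ne_zero _ h.q_ne_zero)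
    one_ne_zero h.a_ne_zero (h.qPoch_base (by omega))
    (by rw [div_one]; exact h.qPoch_base (by omega))
    (by rw [one_mul]; exact h.qPoch_base (by omega)) (h.qPoch_sq hk)

theorem balSum_one_right_evalsTo (ha : EvalsTo φ a a') (hq : EvalsTo φ q q')
    (h : NonVanishing d r n M a' q') (hM : M < n) :
    EvalsTo φ (balSum d r M a 1 q) (balSum d r M a' 1 q') := by
  refine EvalsTo.sum fun k hk => ?_
  have hk : k ≤ M := Nat.lt_succ_iff.1 (Finset.mem_range.1 hk)
  exact balTerm_evalsTo (hq.pow r) (hq.pow d) ha (EvalsTo.one φ) (pow_ne_zero _ h.q_ne_zero)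
    h.a_ne_zero one_ne_zero (h.qPoch_base (by omega))
    (h.qPoch_div (by omega)) (h.qPoch_mul (by omega)) (h.qPoch_sq hk)

theorem rightSide_evalsTo (ha : EvalsTo φ a a') (hq : EvalsTo φ q q')
    (h : NonVanishing d r n M a' q') (hM : M < n) :
    EvalsTo φ (rightSide d r n m M a q) (rightSide d r n m M a' q') := by
  have h1 := EvalsTo.one φ
  have h2 : EvalsTo φ (2 : FractionRing R) 2 := by simpa using EvalsTo.natCast φ 2
  have hx := hq.pow n
  have h1a := (h1.sub ha).pow 2
  have h1a0 : (1 - a') ^ 2 ≠ 0 := pow_ne_zero 2 h.a_ne_one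
  exact ((prefactor_evalsTo hq h hM).pow m).mul
    ((((((h1.sub hx).pow 2).mul ((h1.add (ha.pow 2)).sub (ha.mul hx))).div h1a h1a0).mul
      ((balSum_one_left_evalsTo ha hq h hM).pow m)).sub
    (((((h2.sub hx).mul (h1.sub (ha.mul hx))).mul (ha.sub hx)).div h1a h1a0).mul
      ((balSum_one_right_evalsTo ha hq h hM).pow m)))

end Evaluations

/-! ### Complex test points for the denominators. -/

section Points

theorem two_pow_ne_one {s : ℕ} (hs : 0 < s) : (2 : ℂ) ^ s ≠ 1 := by
  have : (2 : ℕ) ^ s ≠ 1 := (Nat.one_lt_two_pow hs.ne').ne'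
  exact_mod_cast this

theorem two_pow_ne_two_pow {s t : ℕ} (h : s ≠ t) : (2 : ℂ) ^ s ≠ 2 ^ t := by
  have : (2 : ℕ) ^ s ≠ 2 ^ t := fun h' => h (Nat.pow_right_injective le_rfl h')
  exact_mod_cast this

variable {d r n M : ℕ}

theorem mul_ne_of_coprime (hd : 2 ≤ d) (hdn : Nat.Coprime n d) (i : ℕ) : d * i ≠ n := by
  rintro rfl
  have := Nat.eq_one_of_dvd_coprimes hdn (dvd_mul_right d i) dvd_rfl
  omega

/-- Everything compares powers of 2. Only q^d/a needs arithmetic: d(i + 1) ≠ n, because d ≥ 2 is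
coprime to n. -/
theorem nonVanishing_two_pow (hd : 2 ≤ d) (hr : 0 < r) (hdn : Nat.Coprime n d) (hn : 0 < n) :
    NonVanishing d r n M ((2 : ℂ) ^ n) 2 where
  q_ne_zero := two_ne_zero
  a_ne_zero := pow_ne_zero _ two_ne_zero
  q_ne_one := by norm_num
  a_ne_one := sub_ne_zero.2 (two_pow_ne_one hn).symm
  pow_ne_one i _ := by rw [← pow_mul, ← pow_add]; exact two_pow_ne_one (by omega)
  mul_pow_ne_one i _ := by rw [← pow_mul, ← pow_add, ← pow_add]; exact two_pow_ne_one (by omega)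
  div_pow_ne_one i _ := by
    rw [div_mul_eq_mul_div, Ne, div_eq_one_iff_eq (pow_ne_zero _ two_ne_zero), ← pow_mul, ← pow_add]
    refine two_pow_ne_two_pow ?_
    have := mul_ne_of_coprime hd hdn (1 + i)
    rwa [mul_add, mul_one] at this
  sq_pow_ne_one i _ := by
    rw [← pow_mul, ← pow_mul, ← pow_add]; exact two_pow_ne_one (by omega)

theorem nonVanishing_two_pow_inv (hd : 2 ≤ d) (hr : 0 < r) (hdn : Nat.Coprime n d) (hn : 0 < n) :
    NonVanishing d r n M ((2 : ℂ) ^ n)⁻¹ 2 := by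
  have h := nonVanishing_two_pow (M := M) hd hr hdn hn
  refine ⟨h.q_ne_zero, inv_ne_zero h.a_ne_zero, h.q_ne_one, ?_, h.pow_ne_one, ?_, ?_,
    h.sq_pow_ne_one⟩
  · rw [sub_ne_zero, Ne, eq_comm, inv_eq_one]
    exact two_pow_ne_one hn
  · intro i hi
    rw [inv_mul_eq_div]
    exact h.div_pow_ne_one i hi
  · intro i hi
    rw [div_inv_eq_mul, mul_comm ((2 : ℂ) ^ d)]
    exact h.mul_pow_ne_one i hi

/-- The number 2r + di lies below 2n, so divisibility would force it to equal n = r + dM. Then d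
would divide r, against coprimality. -/
theorem not_dvd_of_lt (hd : 2 ≤ d) (hrd : Nat.Coprime r d) (hM : r + d * M = n) (hr : 0 < r)
    {i : ℕ} (hi : i < M) : ¬ n ∣ r * 2 + d * i := by
  rintro ⟨c, hc⟩
  have hle : d * (i + 1) ≤ d * M := Nat.mul_le_mul_left d hi
  rw [mul_add, mul_one] at hle
  have hc1 : c = 1 := by
    have h1 : c < 2 := by
      by_contra h
      have : n * 2 ≤ n * c := Nat.mul_le_mul_left n (by omega)
      omega
    have h2 : c ≠ 0 := by
      rintro rfl
      omega
    omega
  rw [hc1, mul_one, ← hM] at hc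
  have h3 : d ∣ r := by
    obtain ⟨j, rfl⟩ := Nat.exists_eq_add_of_lt hi
    refine ⟨j + 1, ?_⟩
    rw [mul_add, mul_add] at hc
    rw [mul_add]
    omega
  have := Nat.eq_one_of_dvd_coprimes hrd h3 dvd_rfl
  omega

/-- The choice a = 2 settles the factors involving a by absolute value; the others follow from the
order of ζ. -/
theorem nonVanishing_root_of_unity (hd : 2 ≤ d) (hr : 0 < r) (hrd : Nat.Coprime r d)
    (hdn : Nat.Coprime n d) (hM : r + d * M = n) (hn : 1 < n) {ζ : ℂ}
    (hζ : IsPrimitiveRoot ζ n) : NonVanishing d r n M 2 ζ := by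
  have hnorm : ‖ζ‖ = 1 := hζ.norm'_eq_one (by omega)
  refine ⟨hζ.ne_zero (by omega), two_ne_zero, sub_ne_zero.2 (hζ.ne_one hn).symm, by norm_num,
    ?_, ?_, ?_, ?_⟩
  · intro i hi
    rw [← pow_mul, ← pow_add, Ne, hζ.pow_eq_one_iff_dvd]
    intro h
    rw [show d + d * i = d * (i + 1) by ring] at h
    have := Nat.le_of_dvd (by omega) (hdn.dvd_of_dvd_mul_left h)
    omega
  · intro i _ h
    have := congrArg norm h
    simp [hnorm] at this
  · intro i _ h
    have := congrArg norm h
    simp [hnorm] at this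
  · intro i hi
    rw [← pow_mul, ← pow_mul, ← pow_add, Ne, hζ.pow_eq_one_iff_dvd]
    exact not_dvd_of_lt hd hrd hM hr hi

end Points

/-! ### The congruence modulo each factor. -/

section Congruences

variable {d r n m M : ℕ}

theorem ratQ_evalsTo {L : Type*} [Field L] (φ : PolyAQ →+* L) : EvalsTo φ ratQ (φ polyQ) :=
  EvalsTo.of_algebraMap φ polyQ

theorem ratA_evalsTo {L : Type*} [Field L] (φ : PolyAQ →+* L) : EvalsTo φ ratA (φ polyA) :=
  EvalsTo.of_algebraMap φ polyA

theorem pow_ne_one_of_ker_le {L : Type*} [Field L] {φ : PolyAQ →+* L} {a : ℂ}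
    (h : ∀ x, φ x = 0 → evalAQ a 2 x = 0) (s : ℕ) (hs : 0 < s) : φ polyQ ^ s ≠ 1 := by
  intro h'
  have := h (polyQ ^ s - 1) (by simp [h'])
  exact two_pow_ne_one hs (sub_eq_zero.1 (by simpa using this))

/-- The congruence modulo a prime at which `a = q ^ n` or `a = q ^ (-n)`. -/
theorem fracCongr_of_prime {p : PolyAQ} (hp : Prime p) (hd : 2 ≤ d) (hr : 0 < r)
    (hM : r + d * M = n) (hmM : m * M ≤ n - 1) {a : ℂ}
    (hpa : evalAQ a 2 p = 0) (hNV : NonVanishing d r n M a 2)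
    (hx : ∀ (L : Type) [Field L] (φ : PolyAQ →+* L), φ p = 0 → φ polyQ ≠ 0 →
      φ polyA = φ polyQ ^ n ∨ φ polyA = (φ polyQ ^ n)⁻¹) :
    FracCongr p (multiSum m (n - 1) (qLambda d r ratA ratQ)) (rightSide d r n m M ratA ratQ) := by
  obtain ⟨L, _, φ, hφ⟩ := exists_residueField hp
  have hker : ∀ x, φ x = 0 → evalAQ a 2 x = 0 := by
    intro x hx
    obtain ⟨c, rfl⟩ := (hφ x).1 hx
    rw [map_mul, hpa, zero_mul]
  have hNV' : NonVanishing d r n M (φ polyA) (φ polyQ) :=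
    NonVanishing.of_ker_le hker (by simpa using hNV)
  have hφp : φ p = 0 := (hφ p).2 dvd_rfl
  have hMn : M < n := by
    have : 1 * M ≤ d * M := Nat.mul_le_mul_right M (by omega)
    omega
  have h1 : EvalsTo φ (multiSum m (n - 1) (qLambda d r ratA ratQ))
      (multiSum m (n - 1) (qLambda d r (φ polyA) (φ polyQ))) :=
    EvalsTo.multiSum fun k hk =>
      qLambda_evalsTo (ratA_evalsTo φ) (ratQ_evalsTo φ) hNV' (by omega)
  have h2 := h1.sub (rightSide_evalsTo (m := m) (ratA_evalsTo φ) (ratQ_evalsTo φ) hNV' hMn)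
  -- Both sides have the same value in the residue field, so their difference has value 0.
  rw [multiSum_qLambda_eq_rightSide (by omega) hr hM hmM hNV'.q_ne_zero
    (pow_ne_one_of_ker_le hker) (hx L φ hφp hNV'.q_ne_zero), sub_self] at h2
  have h3 := (PowDvd.of_evalsTo_zero (fun x hx => (hφ x).1 hx) h2).fracCongr hp.irreducible hφp
  rwa [pow_one] at h3

theorem ratQ_ne_zero : ratQ ≠ 0 := by
  rw [ratQ, Ne, IsFractionRing.to_map_eq_zero_iff]
  exact X_ne_zero

theorem ratA_ne_zero : ratA ≠ 0 := by
  rw [ratA, Ne, IsFractionRing.to_map_eq_zero_iff]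
  exact C_ne_zero.2 X_ne_zero

/-- The congruence modulo the fourth power of the cyclotomic polynomial. -/
theorem fracCongr_cyclotomic (hd : 2 ≤ d) (hr : 0 < r) (hrd : Nat.Coprime r d)
    (hdn : Nat.Coprime n d) (hm : 2 ≤ m) (hM : r + d * M = n) (hmM : m * M ≤ n - 1)
    (hn : 1 < n) :
    FracCongr (cyclotomic n ℚ[X] ^ 4) (multiSum m (n - 1) (qLambda d r ratA ratQ))
      (rightSide d r n m M ratA ratQ) := by
  have hp := cyclotomic_polynomial_prime (show 0 < n by omega)
  generalize hpdef : cyclotomic n ℚ[X] = p at *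
  obtain ⟨L, _, φ, hφ⟩ := exists_residueField hp
  have hφp : φ p = 0 := (hφ p).2 dvd_rfl
  obtain ⟨ζ, hζ⟩ : ∃ ζ : ℂ, IsPrimitiveRoot ζ n := ⟨_, Complex.isPrimitiveRoot_exp n (by omega)⟩
  have hker : ∀ x, φ x = 0 → evalAQ 2 ζ x = 0 := by
    intro x hx
    obtain ⟨c, rfl⟩ := (hφ x).1 hx
    have : evalAQ 2 ζ p = 0 := by
      rw [← hpdef, evalAQ_cyclotomic]
      exact hζ.isRoot_cyclotomic (by omega)
    rw [map_mul, this, zero_mul]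
  have hNV : NonVanishing d r n M (φ polyA) (φ polyQ) :=
    NonVanishing.of_ker_le hker
      (by simpa using nonVanishing_root_of_unity hd hr hrd hdn hM hn hζ)
  -- Needed to conclude from a sum being its own negative.
  have hchar : CharZero L := by
    refine charZero_of_inj_zero fun k hk => ?_
    have := hker k (by simpa using hk)
    simpa using this
  have hMn : M < n := by
    have : 1 * M ≤ d * M := Nat.mul_le_mul_right M (by omega)
    omega
  have hqn : φ polyQ ^ n = 1 := by
    have h : p ∣ polyQ ^ n - 1 := by
      rw [← hpdef]; exact cyclotomic.dvd_X_pow_sub_one n ℚ[X]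
    have := (hφ _).2 h
    exact sub_eq_zero.1 (by simpa using this)
  have hA : ∀ i < M, φ polyQ ^ r * (φ polyQ ^ d) ^ i ≠ 1 := by
    intro i hi h
    have h0 := hker (polyQ ^ r * (polyQ ^ d) ^ i - 1) (by simp [h])
    rw [← pow_mul, ← pow_add, map_sub, map_one, map_pow, evalAQ_polyQ, sub_eq_zero,
      hζ.pow_eq_one_iff_dvd] at h0
    have hle : d * (i + 1) ≤ d * M := Nat.mul_le_mul_left d hi
    rw [mul_add, mul_one] at hle
    have := Nat.le_of_dvd (by omega) h0
    omega
  have hAM : φ polyQ ^ r * (φ polyQ ^ d) ^ M = 1 := by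
    rw [← hqn, ← hM]; ring
  have ha := ratA_evalsTo φ
  have hq := ratQ_evalsTo φ
  have ha0 := hNV.a_ne_zero
  have h1 := EvalsTo.one φ
  have hq1 := h1.sub hq
  have hx := hq.pow n
  have hx1 : PowDvd φ p 1 (1 - ratQ ^ n) := by
    refine PowDvd.of_evalsTo_zero (fun x hx => (hφ x).1 hx) ?_
    simpa [hqn] using h1.sub hx
  have hx0 : φ polyQ ^ n ≠ 0 := by rw [hqn]; exact one_ne_zero
  obtain ⟨y, hy⟩ : ∃ y, y = (1 - ratQ ^ n) ^ 2 / ratQ ^ n := ⟨_, rfl⟩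
  have hyp : PowDvd φ p 2 y := by
    rw [hy, div_eq_mul_inv]
    exact (hx1.pow 2).mul_evalsTo (hx.inv hx0)
  have hQ := ratQ_ne_zero
  have hQn : ratQ ^ n ≠ 0 := pow_ne_zero _ hQ
  -- the sum with `b = q ^ n` agrees with the sum with `b = 1`
  have claim1 : PowDvd φ p 3 (∑ k ∈ Finset.range (M + 1),
        wTerm (ratQ ^ r) (ratQ ^ d) ratA (ratQ ^ n) k / (1 - ratQ) -
      ∑ k ∈ Finset.range (M + 1), qLambda d r ratA ratQ k) := by
    have e : ∑ k ∈ Finset.range (M + 1),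
        wTerm (ratQ ^ r) (ratQ ^ d) ratA (ratQ ^ n) k / (1 - ratQ) -
      ∑ k ∈ Finset.range (M + 1), qLambda d r ratA ratQ k =
      (∑ k ∈ Finset.range (M + 1), (bRatio (ratQ ^ r) (ratQ ^ d) (ratQ ^ n) k -
          bRatio (ratQ ^ r) (ratQ ^ d) 1 k * (1 + y * logDerivSum (ratQ ^ r) (ratQ ^ d) k)) *
          wCoeff (ratQ ^ r) (ratQ ^ d) ratA k +
        y * ∑ k ∈ Finset.range (M + 1), wTerm (ratQ ^ r) (ratQ ^ d) ratA 1 k *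
          logDerivSum (ratQ ^ r) (ratQ ^ d) k) * (1 - ratQ)⁻¹ := by
      rw [Finset.mul_sum, ← Finset.sum_add_distrib, Finset.sum_mul, ← Finset.sum_sub_distrib]
      refine Finset.sum_congr rfl fun k _ => ?_
      rw [qLambda_eq hQ, wTerm_eq_wCoeff_mul_bRatio, wTerm_eq_wCoeff_mul_bRatio]
      ring
    rw [e]
    refine (PowDvd.add (PowDvd.sum fun k hk => ?_) ?_).mul_evalsTo (hq1.inv hNV.q_ne_one)
    · have hk : k ≤ M := Nat.lt_succ_iff.1 (Finset.mem_range.1 hk)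
      refine PowDvd.mul_evalsTo ((bRatio_sub_powDvd hφp (hq.pow r) (hq.pow d) hQn hy hyp k
        (fun i hi => hNV.pow_ne_one i (by omega)) fun i hi => hA i (by omega)).mono (by omega))
        (wCoeff_evalsTo (hq.pow r) (hq.pow d) ha (pow_ne_zero _ hNV.q_ne_zero) ha0
          (hNV.qPoch_base (by omega)) (hNV.qPoch_div (by omega)) (hNV.qPoch_mul (by omega)))
    -- y contributes Φ_n^2, and the reflected sum, zero in the residue field, contributes the third
    -- factor.
    · refine hyp.mul (f := 1) (PowDvd.of_evalsTo_zero (fun x hx => (hφ x).1 hx) ?_)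
      have hs := sum_wTerm_mul_logDerivSum_eq_zero hAM (pow_ne_zero d hNV.q_ne_zero) ha0
        (fun i hi => hNV.pow_ne_one i (by omega)) (fun i hi => hNV.mul_pow_ne_one i (by omega))
        (fun i hi => hNV.div_pow_ne_one i (by omega))
      rw [← hs]
      refine EvalsTo.sum fun k hk => ?_
      have hk : k ≤ M := Nat.lt_succ_iff.1 (Finset.mem_range.1 hk)
      exact (wTerm_one_evalsTo ha hq hNV (by omega)).mul
        (logDerivSum_evalsTo (hq.pow r) (hq.pow d)
          (fun i hi => hNV.pow_ne_one i (by omega)) fun i hi => hA i (by omega))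
  have hpre : PowDvd φ p 1 (prefactor d r n M ratQ) := by
    refine PowDvd.of_evalsTo_zero (fun x hx => (hφ x).1 hx) ?_
    have := prefactor_evalsTo hq hNV hMn
    rwa [show prefactor d r n M (φ polyQ) = 0 by simp [prefactor, qInt, hqn]] at this
  have claim2 : PowDvd φ p 2 (balSum d r M ratA (ratQ ^ n) ratQ - balSum d r M ratA 1 ratQ) := by
    rw [balSum, balSum, ← Finset.sum_sub_distrib]
    refine PowDvd.sum fun k hk => ?_
    have hk : k ≤ M := Nat.lt_succ_iff.1 (Finset.mem_range.1 hk)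
    have hA' := hq.pow r
    have hQ' := hq.pow d
    have e : balTerm (ratQ ^ r) (ratQ ^ d) ratA (ratQ ^ n) k -
        balTerm (ratQ ^ r) (ratQ ^ d) ratA 1 k =
        (qPoch (ratQ ^ n * ratQ ^ r) (ratQ ^ d) k * qPoch (ratQ ^ r / ratQ ^ n) (ratQ ^ d) k -
          qPoch (ratQ ^ r) (ratQ ^ d) k * qPoch (ratQ ^ r) (ratQ ^ d) k) *
        ((qPoch (ratQ ^ r) (ratQ ^ d) k * qPoch (ratQ ^ d / ratQ ^ r) (ratQ ^ d) k) /
          (qPoch (ratA * ratQ ^ d) (ratQ ^ d) k * qPoch (ratQ ^ d / ratA) (ratQ ^ d) k *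
            qPoch (ratQ ^ d) (ratQ ^ d) k * qPoch ((ratQ ^ r) ^ 2) (ratQ ^ d) k) *
          (ratQ ^ d) ^ k) := by
      simp only [balTerm, one_mul, div_one]
      ring
    rw [e]
    exact (qPoch_mul_sub_powDvd hφp hA' hQ' hQn hy hyp k).mul_evalsTo
      (((((hA'.qPoch hQ' k).mul ((hQ'.div hA' (pow_ne_zero _ hNV.q_ne_zero)).qPoch hQ' k))).div
        (((((ha.mul hQ').qPoch hQ' k).mul ((hQ'.div ha ha0).qPoch hQ' k)).mul
          (hQ'.qPoch hQ' k)).mul ((hA'.pow 2).qPoch hQ' k))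
        (mul_ne_zero (mul_ne_zero (mul_ne_zero (hNV.qPoch_mul (by omega))
          (hNV.qPoch_div (by omega))) (hNV.qPoch_base (by omega))) (hNV.qPoch_sq hk))).mul
        (hQ'.pow k))
  -- Watson's transformation in the field of rational functions
  have hwatson : ∑ k ∈ Finset.range (M + 1),
        wTerm (ratQ ^ r) (ratQ ^ d) ratA (ratQ ^ n) k / (1 - ratQ) =
      prefactor d r n M ratQ * balSum d r M ratA (ratQ ^ n) ratQ := by
    -- The kernel is zero here, so any test point would serve for the denominators.
    have hinj : ∀ x : PolyAQ, algebraMap PolyAQ RatAQ x = 0 → evalAQ (2 ^ n) 2 x = 0 := by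
      intro x hx
      rw [IsFractionRing.to_map_eq_zero_iff] at hx
      rw [hx, map_zero]
    have hNVF : NonVanishing d r n M ratA ratQ := NonVanishing.of_ker_le hinj
      (by simpa using nonVanishing_two_pow hd hr hdn (by omega))
    exact sum_wTerm_eq_prefactor_mul_balSum (by omega) hr hM hQ ratA_ne_zero
      (pow_ne_one_of_ker_le hinj) (fun i hi => hNVF.mul_pow_ne_one i (by omega))
      (fun i hi => hNVF.div_pow_ne_one i (by omega))
  obtain ⟨s, hs, hsum⟩ := multiSum_eq_pow_add hmM (qLambda d r ratA ratQ)
  -- Each remaining tuple has an entry k with M < k < n, and (q^r;q^d)_k then contains 1 - q^n.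
  have hrest : PowDvd φ p 4 (∑ i ∈ s, ∏ j, qLambda d r ratA ratQ (i j)) := by
    refine PowDvd.sum fun i hi => ?_
    obtain ⟨hiN, j, hj⟩ := hs i hi
    refine prod_powDvd (fun j _ => qLambda_evalsTo ha hq hNV (k := i j) ?_) (Finset.mem_univ j) ?_
    · have := hiN j
      omega
    · have hjn : i j < n := by
        have := hiN j
        omega
      generalize i j = k at *
      have hA' := hq.pow r
      have hQ' := hq.pow d
      have e : qLambda d r ratA ratQ k = qPoch (ratQ ^ r) (ratQ ^ d) k ^ 4 *
          ((1 - ratQ ^ r * (ratQ ^ d) ^ (2 * k)) *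
            ((qPoch (ratA * ratQ ^ r) (ratQ ^ d) k * qPoch (ratQ ^ r / ratA) (ratQ ^ d) k) /
              (qPoch (ratQ ^ d) (ratQ ^ d) k ^ 4 *
                (qPoch (ratQ ^ d / ratA) (ratQ ^ d) k * qPoch (ratA * ratQ ^ d) (ratQ ^ d) k))) *
            ((ratQ ^ d) ^ 2 / (ratQ ^ r) ^ 3) ^ k / (1 - ratQ)) := by
        rw [qLambda_eq hQ, wTerm]
        simp only [one_mul, div_one]
        ring
      rw [e]
      have hrest := ((h1.sub (hA'.mul (hQ'.pow (2 * k)))).mul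
        ((((ha.mul hA').qPoch hQ' k).mul ((hA'.div ha ha0).qPoch hQ' k)).div
          (((hQ'.qPoch hQ' k).pow 4).mul
            (((hQ'.div ha ha0).qPoch hQ' k).mul ((ha.mul hQ').qPoch hQ' k)))
          (mul_ne_zero (pow_ne_zero 4 (hNV.qPoch_base hjn))
            (mul_ne_zero (hNV.qPoch_div hjn) (hNV.qPoch_mul hjn))))).mul
        (((hQ'.pow 2).div (hA'.pow 3) (pow_ne_zero 3 (pow_ne_zero r hNV.q_ne_zero))).pow k)
      refine PowDvd.mul_evalsTo (PowDvd.pow (e := 1)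
        (PowDvd.of_evalsTo_zero (fun x hx => (hφ x).1 hx) ?_) 4) (hrest.div hq1 hNV.q_ne_one)
      rw [← qPoch_eq_zero hj hAM]
      exact hA'.qPoch hQ' k
  have hT : PowDvd φ p 1 (prefactor d r n M ratQ * balSum d r M ratA 1 ratQ) :=
    hpre.mul_evalsTo (balSum_one_right_evalsTo ha hq hNV hMn)
  have hST : PowDvd φ p 3 (∑ k ∈ Finset.range (M + 1), qLambda d r ratA ratQ k -
      prefactor d r n M ratQ * balSum d r M ratA 1 ratQ) := by
    have := (hpre.mul claim2).sub claim1
    rw [hwatson] at this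
    refine (congrArg (PowDvd φ p 3) ?_).mp this
    ring
  have hS : PowDvd φ p 1 (∑ k ∈ Finset.range (M + 1), qLambda d r ratA ratQ k) := by
    have := (hST.mono (show 1 ≤ 3 by omega)).add hT
    rwa [sub_add_cancel] at this
  have hpow := pow_sub_pow_powDvd hS hT hST hm
  have ha1 := (h1.sub ha).ne_zero hNV.a_ne_one
  -- The two signed coefficients on the right add up to 1.
  have hE : -((2 - ratQ ^ n) * (1 - ratA * ratQ ^ n) * (ratA - ratQ ^ n) / (1 - ratA) ^ 2) =
      1 - (1 - ratQ ^ n) ^ 2 * ((1 + ratA ^ 2 - ratA * ratQ ^ n) / (1 - ratA) ^ 2) := by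
    field_simp
    ring
  have hB1 := balSum_one_left_evalsTo ha hq hNV hMn
  have hB2 := balSum_one_right_evalsTo ha hq hNV hMn
  refine PowDvd.fracCongr hp.irreducible hφp ?_
  have e : multiSum m (n - 1) (qLambda d r ratA ratQ) - rightSide d r n m M ratA ratQ =
      (∑ k ∈ Finset.range (M + 1), qLambda d r ratA ratQ k) ^ m -
        (prefactor d r n M ratQ * balSum d r M ratA 1 ratQ) ^ m +
      ∑ i ∈ s, ∏ j, qLambda d r ratA ratQ (i j) -
      prefactor d r n M ratQ ^ m * (1 - ratQ ^ n) ^ 2 *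
        ((1 + ratA ^ 2 - ratA * ratQ ^ n) / (1 - ratA) ^ 2 *
          (balSum d r M 1 ratA ratQ ^ m - balSum d r M ratA 1 ratQ ^ m)) := by
    rw [hsum, rightSide, sub_eq_add_neg (_ * balSum d r M 1 ratA ratQ ^ m), ← neg_mul, hE]
    ring
  rw [e]
  have hfac := (((h1.add (ha.pow 2)).sub (ha.mul hx)).div ((h1.sub ha).pow 2)
    (pow_ne_zero 2 hNV.a_ne_one)).mul ((hB1.pow m).sub (hB2.pow m))
  -- The last error carries Φ_n^m from the prefactor and Φ_n^2 from (1 - q^n)^2, and m + 2 ≥ 4.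
  exact (hpow.add hrest).sub
    ((PowDvd.mul_evalsTo ((hpre.pow m).mul (hx1.pow 2)) hfac).mono (by omega))

end Congruences

/-! ### The case n = 1, coprimality of the moduli, and the conclusion. -/

theorem fracCongr_self {R : Type*} [CommRing R] [IsDomain R] (P : R) (A : FractionRing R) :
    FracCongr P A A :=
  ⟨0, 1, one_ne_zero, isRelPrime_one_left, by simp⟩

/-- Only the zero tuple occurs, both balanced sums are 1, and the signed coefficients add up to 1.
-/
theorem multiSum_qLambda_eq_rightSide_of_eq_one {K : Type*} [Field K] {a q : K} {d m : ℕ}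
    (hq : 1 - q ≠ 0) (ha : 1 - a ≠ 0) :
    multiSum m (1 - 1) (qLambda d 1 a q) = rightSide d 1 1 m 0 a q := by
  obtain ⟨s, hs, h⟩ := multiSum_eq_pow_add (m := m) (M := 0) (N := 0) (by simp) (qLambda d 1 a q)
  have hs0 : s = ∅ := by
    refine Finset.eq_empty_of_forall_notMem fun i hi => ?_
    obtain ⟨h1, j, hj⟩ := hs i hi
    exact absurd (h1 j) (by omega)
  have e : (1 - q) ^ 2 * (1 + a ^ 2 - a * q) / (1 - a) ^ 2 -
      (2 - q) * (1 - a * q) * (a - q) / (1 - a) ^ 2 = 1 := by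
    field_simp
    ring
  rw [Nat.sub_self, h, hs0]
  simp [rightSide, prefactor, balSum, balTerm, qLambda, qInt, hq, e]

/-- Each non-divisibility is witnessed by a point killing one factor but not the other: (2, ζ) for
Φ_n, and (2^(-n), 2) for 1 - aq^n. -/
theorem modulusAQ_relPrime {n : ℕ} (hn : 0 < n) :
    IsRelPrime (cyclotomic n ℚ[X] ^ 4) (1 - polyA * polyQ ^ n) ∧
      IsRelPrime (cyclotomic n ℚ[X] ^ 4 * (1 - polyA * polyQ ^ n)) (polyA - polyQ ^ n) := by
  have hp := (cyclotomic_polynomial_prime hn).irreducible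
  have hζ : IsPrimitiveRoot (Complex.exp (2 * Real.pi * Complex.I / n)) n :=
    Complex.isPrimitiveRoot_exp n hn.ne'
  generalize Complex.exp (2 * Real.pi * Complex.I / n) = ζ at hζ
  have hc : evalAQ 2 ζ (cyclotomic n ℚ[X]) = 0 := by
    rw [evalAQ_cyclotomic]
    exact hζ.isRoot_cyclotomic hn
  have key : ∀ x, evalAQ 2 ζ x ≠ 0 → IsRelPrime (cyclotomic n ℚ[X] ^ 4) x := by
    intro x hx
    refine IsRelPrime.pow_left (hp.isRelPrime_iff_not_dvd.2 ?_)
    rintro ⟨c, rfl⟩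
    rw [map_mul, hc, zero_mul] at hx
    exact hx rfl
  refine ⟨key _ ?_, IsRelPrime.mul_left (key _ ?_)
    ((one_sub_polyA_mul_pow_prime n).irreducible.isRelPrime_iff_not_dvd.2 ?_)⟩
  · simp only [map_sub, map_mul, map_pow, map_one, evalAQ_polyA, evalAQ_polyQ, hζ.pow_eq_one]
    norm_num
  · simp only [map_sub, map_pow, evalAQ_polyA, evalAQ_polyQ, hζ.pow_eq_one]
    norm_num
  · rintro ⟨c, hc⟩
    have h := congrArg (evalAQ ((2 : ℂ) ^ n)⁻¹ 2) hc
    have h2 : ((2 : ℂ) ^ n) ≠ 0 := pow_ne_zero _ two_ne_zero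
    simp only [map_sub, map_mul, map_pow, map_one, evalAQ_polyA, evalAQ_polyQ,
      inv_mul_cancel₀ h2, sub_self, zero_mul, sub_eq_zero] at h
    refine two_pow_ne_one (show 0 < n + n by omega) ?_
    rw [pow_add]
    nth_rewrite 1 [← h]
    exact inv_mul_cancel₀ h2

theorem mainTheorem4 (d m n r : ℕ) (hr : 0 < r) (hrn : r ≤ n) (hnr : n ≡ r [MOD d])
    (hrd : Nat.Coprime r d) (hm : 2 ≤ m) (hmd : m ≤ d) :
    FracCongr (modulusAQ n)
      (multiSum m (n - 1) (qLambda d r ratA ratQ))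
      (qInt ratQ n ^ m * ratQ ^ (((m : ℤ) * (r : ℤ) * ((r : ℤ) - (n : ℤ))) / (d : ℤ)) *
          ((1 - ratQ ^ n) ^ 2 * (1 + ratA ^ 2 - ratA * ratQ ^ n) / (1 - ratA) ^ 2) *
          (qPoch (ratQ ^ (2 * r)) (ratQ ^ d) ((n - r) / d) ^ m / qPoch (ratQ ^ d) (ratQ ^ d) ((n - r) / d) ^ m) *
          (∑ k ∈ Finset.range ((n - r) / d + 1),
            (qPoch (ratA * ratQ ^ r) (ratQ ^ d) k * qPoch (ratQ ^ r / ratA) (ratQ ^ d) k * qPoch (ratQ ^ r) (ratQ ^ d) k *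
                qPoch (ratQ ^ ((d : ℤ) - (r : ℤ))) (ratQ ^ d) k) /
              (qPoch (ratQ ^ d) (ratQ ^ d) k ^ 3 * qPoch (ratQ ^ (2 * r)) (ratQ ^ d) k) *
              ratQ ^ (d * k)) ^ m
        - qInt ratQ n ^ m * ratQ ^ (((m : ℤ) * (r : ℤ) * ((r : ℤ) - (n : ℤ))) / (d : ℤ)) *
          ((2 - ratQ ^ n) * (1 - ratA * ratQ ^ n) * (ratA - ratQ ^ n) / (1 - ratA) ^ 2) *
          (qPoch (ratQ ^ (2 * r)) (ratQ ^ d) ((n - r) / d) ^ m / qPoch (ratQ ^ d) (ratQ ^ d) ((n - r) / d) ^ m) *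
          (∑ k ∈ Finset.range ((n - r) / d + 1),
            (qPoch (ratQ ^ r) (ratQ ^ d) k ^ 3 * qPoch (ratQ ^ ((d : ℤ) - (r : ℤ))) (ratQ ^ d) k) /
              (qPoch (ratA * ratQ ^ d) (ratQ ^ d) k * qPoch (ratQ ^ d / ratA) (ratQ ^ d) k *
                qPoch (ratQ ^ d) (ratQ ^ d) k * qPoch (ratQ ^ (2 * r)) (ratQ ^ d) k) *
              ratQ ^ (d * k)) ^ m) := by
  have hn : 0 < n := by omega
  obtain ⟨M, hM⟩ : ∃ M, r + d * M = n := by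
    obtain ⟨M, hM⟩ := (Nat.modEq_iff_dvd' hrn).1 hnr.symm
    exact ⟨M, by omega⟩
  have hdn : Nat.Coprime n d := by
    rw [← hM]
    simpa using hrd
  have hmM : m * M ≤ n - 1 := by
    have : m * M ≤ d * M := Nat.mul_le_mul_right M hmd
    omega
  rw [rightSide_eq (by omega) hM ratQ_ne_zero]
  rcases Nat.lt_or_ge 1 n with h1 | h1
  · obtain ⟨hr1, hr2⟩ := modulusAQ_relPrime hn
    refine ((fracCongr_cyclotomic (by omega) hr hrd hdn hm hM hmM h1).mul_modulus hr1 ?_).mul_modulus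
      hr2 ?_
    · refine fracCongr_of_prime (one_sub_polyA_mul_pow_prime n) (by omega) hr hM hmM
        (a := ((2 : ℂ) ^ n)⁻¹) ?_ (nonVanishing_two_pow_inv (by omega) hr hdn hn)
        fun L _ φ h _ => Or.inr ?_
      · simp
      · refine eq_inv_of_mul_eq_one_left ?_
        simp only [map_sub, map_mul, map_pow, map_one] at h
        exact (sub_eq_zero.1 h).symm
    · refine fracCongr_of_prime (polyA_sub_pow_prime n) (by omega) hr hM hmM
        (a := (2 : ℂ) ^ n) ?_ (nonVanishing_two_pow (by omega) hr hdn hn)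
        fun L _ φ h _ => Or.inl ?_
      · simp
      · simp only [map_sub, map_pow] at h
        exact sub_eq_zero.1 h
  -- Here Φ_1 = q - 1 divides the denominators 1 - q, so the residue field argument is unavailable;
  -- both sides are equal outright.
  · obtain rfl : n = 1 := by omega
    obtain rfl : r = 1 := by omega
    obtain rfl : M = 0 := by
      rcases Nat.eq_zero_or_pos M with h | h
      · exact h
      · have := Nat.mul_pos (show 0 < d by omega) h
        omega
    have hne : ∀ x : PolyAQ, evalAQ 2 2 x ≠ 0 → algebraMap PolyAQ RatAQ x ≠ 0 := by
      intro x hx h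
      rw [IsFractionRing.to_map_eq_zero_iff] at h
      rw [h, map_zero] at hx
      exact hx rfl
    have hq := hne (1 - polyQ) (by simp; norm_num)
    have ha := hne (1 - polyA) (by simp; norm_num)
    rw [map_sub, map_one] at hq ha
    rw [multiSum_qLambda_eq_rightSide_of_eq_one (a := ratA) (q := ratQ) hq ha]
    exact fracCongr_self _ _
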